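/- Let $M>0$, $0<|a|<M$, $\Delta(r)=r^2-2Mr+a^2$, $\rho^2=r^2+a^2\cos^2\theta$, $\sigma^2=(r^2+a^2)^2-a^2\Delta\sin^2\theta$, $r_\pm=M\pm\sqrt{M^2-a^2}$. Consider the Kerr blocks $M_{\rm I}=\mathbb R_t\times(r_+,\infty)_r\times\mathbb S^2_{\theta,\varphi}$ (the exterior) and $M_{\rm II}=\mathbb R_t\times(r_-,r_+)_r\times\mathbb S^2_{\theta,\varphi}$ with the metric $$g=-\Big(1-\frac{2Mr}{\rho^2}\Big)dt^2-\frac{4aMr\sin^2\theta}{\rho^2}\,dt\,d\varphi+\frac{\rho^2}{\Delta}dr^2+\rho^2d\theta^2+\frac{\sigma^2}{\rho^2}\sin^2\theta\,d\varphi^2 ,$$ where $M_{\rm I}$ is time-oriented by declaring $-\nabla t$ future directed. Let $v_{\mathcal I}=\partial_t$ and $v_{\mathcal H}=\partial_t+\Omega_{\mathcal H}\partial_\varphi$ with $\Omega_{\mathcal H}=a/(r_+^2+a^2)$, and let $t^*=t+x(r)$, where $x(r)=r+\frac1{2\kappa_+}\ln|r-r_+|+\frac1{2\kappa_-}\ln|r-r_-|$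 and $\kappa_\pm=\frac{r_\pm-r_\mp}{2(r_\pm^2+a^2)}$. A null geodesic with tangent $\dot x$ has the first integrals $E=-g(\partial_t,\dot x)$, $L=g(\partial_\varphi,\dot x)$, the Carter constant $K=\Delta\, g(l_+,\dot x)\,g(l_-,\dot x)$ with $l_\pm=\frac{r^2+a^2}{\Delta}\partial_t\pm\partial_r+\frac a\Delta\partial_\varphi$, and $Q=K-(L-aE)^2$. Its radial potential is $R(r)=\big((r^2+a^2)E-aL\big)^2-\Delta(r)K$, and a double zero of $R$ is an $r$ with $R(r)=R'(r)=0$. Below, $R$ always denotes the radial potential of a null geodesic of $M_{\rm I}$ or $M_{\rm II}$. A null geodesic in $M_{\rm I}$ is understood to be affinely parametrized and maximal in $M_{\rm I}$, with parameter interval $(s_-,s_+)$, $-\infty\le s_-<s_+\le+\infty$; it starts at $r_+$ (resp. at $\infty$) if $r(s)\to r_+$ (resp. $r(s)\to\infty$) as $s\to s_-$. Then the following hold. 1. For all $0<|a|<M$ and every future directed null geodesic in $M_{\rm I}$: $\lim_{s\to s_\pm}t(s)=\pm\infty$; and $\lim_{s\to s_-}t^*(s)=-\infty$ if the geodesic starts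 at $r_+$. 2. There exists $0<a_0\le1$ such that, whenever $0<|a|/M<a_0$, every future directed null geodesic in $M_{\rm I}$ which starts neither at $r_+$ nor at $\infty$ passes through an open region of $M_{\rm I}$ on which $v_{\mathcal H}$ and $v_{\mathcal I}$ are both timelike. 3. For all $0<|a|<M$, $R$ has no double zeros in $(r_-,r_+)$. 4. There exist $0<a_0<1$ and $C>0$ such that, whenever $0<|a|/M\le a_0$ and $E\ne0$, every double zero of $R$ in $[r_-,\infty)$ lies in $[3M-C|a|,\,3M+C|a|]$, and if there is such a double zero then $|L/E|\le CM$ and $|Q/E^2|\le CM^2$. 5. There exists $0<a_1\le1$ such that, whenever $0<|a|/M<a_1$, at every point of $\mathbb R_t\times[r_+,\infty)\times\mathbb S^2$ whose radius $r$ is a double zero of $R$ one has $r>r_+$, and $v_{\mathcal H}$ and $v_{\mathcal I}$ are future directed timelike there. -/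

import Mathlib

open Filter Topology

namespace Kerr

noncomputable section

/-- Points and tangent vectors. The exterior `ℝ_t × ]r₊, ∞[_r × S²` is identified with the open
subset `{|(x 1, x 2, x 3)| > r₊}` of `ℝ⁴` by the diffeomorphism
`(t, r, θ, φ) ↦ (t, r sin θ cos φ, r sin θ sin φ, r cos θ)`, which is a single global chart
containing the axis `sin θ = 0`. The coordinate `x 0` is the Boyer-Lindquist time `t`. The block
`ℝ_t × ]r₋, r₊[_r × S²` is treated in the same way. -/
abbrev Pt : Type := Fin 4 → ℝ

/-- The outer horizon radius `r₊`. -/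
def rPlus (M a : ℝ) : ℝ := M + √(M ^ 2 - a ^ 2)

/-- The inner horizon radius `r₋`. -/
def rMinus (M a : ℝ) : ℝ := M - √(M ^ 2 - a ^ 2)

/-- `Δ(r) = r² - 2 M r + a²`. -/
def Delta (M a r : ℝ) : ℝ := r ^ 2 - 2 * M * r + a ^ 2

/-- The Boyer-Lindquist radius `r` of a point. -/
def rad (x : Pt) : ℝ := √(x 1 ^ 2 + x 2 ^ 2 + x 3 ^ 2)

/-- `cos θ`. -/
def cosTheta (x : Pt) : ℝ := x 3 / rad x

/-- `ρ² = r² + a² cos² θ`. -/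
def rhoSq (a : ℝ) (x : Pt) : ℝ := rad x ^ 2 + a ^ 2 * cosTheta x ^ 2

/-- The block `M_I = ℝ × ]r₊, ∞[ × S²` (the Kerr exterior). -/
def exterior (M a : ℝ) : Set Pt := {x | rPlus M a < rad x}

/-- The block `M_II = ℝ × ]r₋, r₊[ × S²`. -/
def blockII (M a : ℝ) : Set Pt := {x | rMinus M a < rad x ∧ rad x < rPlus M a}

/-- The one-form `dr`. -/
def dr (x v : Pt) : ℝ := (x 1 * v 1 + x 2 * v 2 + x 3 * v 3) / rad x

/-- The one-form `sin² θ dφ`. -/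
def sinSqDphi (x v : Pt) : ℝ := (x 1 * v 2 - x 2 * v 1) / rad x ^ 2

/-- The round metric `dθ² + sin² θ dφ²`. -/
def sphereMetric (x v w : Pt) : ℝ :=
  (v 1 * w 1 + v 2 * w 2 + v 3 * w 3 - dr x v * dr x w) / rad x ^ 2

/-- The Kerr metric `g`. Since `σ² / ρ² = ρ² + a² sin² θ (1 + 2 M r / ρ²)`, this is
`-(1 - 2Mr/ρ²) dt² - (4aMr sin²θ/ρ²) dt dφ + (ρ²/Δ) dr² + ρ² dθ² + (σ²/ρ²) sin²θ dφ²`,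
see `metric_boyerLindquist`. -/
def metric (M a : ℝ) (x v w : Pt) : ℝ :=
  -(1 - 2 * M * rad x / rhoSq a x) * (v 0 * w 0)
    - 2 * a * M * rad x / rhoSq a x * (v 0 * sinSqDphi x w + w 0 * sinSqDphi x v)
    + rhoSq a x / Delta M a (rad x) * (dr x v * dr x w)
    + rhoSq a x * sphereMetric x v w
    + a ^ 2 * (1 + 2 * M * rad x / rhoSq a x) * (sinSqDphi x v * sinSqDphi x w)

/-- The point with Boyer-Lindquist coordinates `(t, r, θ, φ)`. -/
def blPoint (t r θ φ : ℝ) : Pt :=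
  ![t, r * (Real.sin θ * Real.cos φ), r * (Real.sin θ * Real.sin φ), r * Real.cos θ]

/-- The vector `t' ∂_t + r' ∂_r + θ' ∂_θ + φ' ∂_φ` at `blPoint t r θ φ`. -/
def blVector (r θ φ t' r' θ' φ' : ℝ) : Pt :=
  ![t',
    r' * (Real.sin θ * Real.cos φ)
      + r * (θ' * Real.cos θ * Real.cos φ - φ' * Real.sin θ * Real.sin φ),
    r' * (Real.sin θ * Real.sin φ)
      + r * (θ' * Real.cos θ * Real.sin φ + φ' * Real.sin θ * Real.cos φ),
    r' * Real.cos θ - r * (θ' * Real.sin θ)]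

lemma rad_blPoint {t r θ φ : ℝ} (hr : 0 < r) : rad (blPoint t r θ φ) = r := by
  have h : (r * (Real.sin θ * Real.cos φ)) ^ 2 + (r * (Real.sin θ * Real.sin φ)) ^ 2
      + (r * Real.cos θ) ^ 2 = r ^ 2 := by
    linear_combination r ^ 2 * Real.sin θ ^ 2 * Real.sin_sq_add_cos_sq φ
      + r ^ 2 * Real.sin_sq_add_cos_sq θ
  simp only [rad, blPoint]
  simp [h, Real.sqrt_sq hr.le]

/-- In Boyer-Lindquist coordinates `metric` is the usual Kerr metric. -/
lemma metric_boyerLindquist {M a t r θ φ t' r' θ' φ' ρ2 σ2 : ℝ} (hr : 0 < r)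
    (hρ : ρ2 = r ^ 2 + a ^ 2 * Real.cos θ ^ 2)
    (hσ : σ2 = (r ^ 2 + a ^ 2) ^ 2 - a ^ 2 * Delta M a r * Real.sin θ ^ 2) :
    metric M a (blPoint t r θ φ) (blVector r θ φ t' r' θ' φ') (blVector r θ φ t' r' θ' φ')
      = -(1 - 2 * M * r / ρ2) * t' ^ 2 - 4 * a * M * r * Real.sin θ ^ 2 / ρ2 * (t' * φ')
        + ρ2 / Delta M a r * r' ^ 2 + ρ2 * θ' ^ 2 + σ2 / ρ2 * Real.sin θ ^ 2 * φ' ^ 2 := by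
  have hr0 : r ≠ 0 := hr.ne'
  have hρ0 : ρ2 ≠ 0 := by rw [hρ]; positivity
  have hθ := Real.sin_sq_add_cos_sq θ
  have hφ := Real.sin_sq_add_cos_sq φ
  have hc : cosTheta (blPoint t r θ φ) = Real.cos θ := by
    simp only [cosTheta, rad_blPoint hr]
    simp [blPoint, hr0]
  have hR : rhoSq a (blPoint t r θ φ) = ρ2 := by
    simp only [rhoSq, hc, rad_blPoint hr, hρ]
  have hdr : dr (blPoint t r θ φ) (blVector r θ φ t' r' θ' φ') = r' := by
    simp only [dr, rad_blPoint hr]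
    rw [div_eq_iff hr0]
    simp [blPoint, blVector]
    linear_combination (r' * r * Real.sin θ ^ 2 + r ^ 2 * θ' * Real.sin θ * Real.cos θ) * hφ
      + r' * r * hθ
  have hb : sinSqDphi (blPoint t r θ φ) (blVector r θ φ t' r' θ' φ')
      = Real.sin θ ^ 2 * φ' := by
    simp only [sinSqDphi, rad_blPoint hr]
    rw [div_eq_iff (pow_ne_zero 2 hr0)]
    simp [blPoint, blVector]
    linear_combination r ^ 2 * Real.sin θ ^ 2 * φ' * hφ
  have hs : sphereMetric (blPoint t r θ φ) (blVector r θ φ t' r' θ' φ')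
      (blVector r θ φ t' r' θ' φ') = θ' ^ 2 + Real.sin θ ^ 2 * φ' ^ 2 := by
    simp only [sphereMetric, hdr, rad_blPoint hr]
    rw [div_eq_iff (pow_ne_zero 2 hr0)]
    simp [blVector]
    linear_combination (r' ^ 2 * Real.sin θ ^ 2 + r ^ 2 * θ' ^ 2 * Real.cos θ ^ 2
      + r ^ 2 * φ' ^ 2 * Real.sin θ ^ 2 + 2 * r * r' * θ' * Real.sin θ * Real.cos θ) * hφ
      + (r' ^ 2 + r ^ 2 * θ' ^ 2) * hθ
  have hv0 : blVector r θ φ t' r' θ' φ' 0 = t' := by simp [blVector]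
  have hσ' : σ2 / ρ2 = ρ2 + a ^ 2 * Real.sin θ ^ 2 * (1 + 2 * M * r / ρ2) := by
    field_simp
    rw [hσ, hρ, Delta]
    have : Real.cos θ ^ 2 = 1 - Real.sin θ ^ 2 := by linear_combination hθ
    rw [this]; ring
  simp only [metric, hR, hdr, hb, hs, hv0, rad_blPoint hr, hσ']
  ring

/-- The `i`-th partial derivative. -/
def partialDeriv (i : Fin 4) (f : Pt → ℝ) (x : Pt) : ℝ := fderiv ℝ f x (Pi.single i 1)

/-- The components `g_{ij}`. -/
def metricComp (M a : ℝ) (i j : Fin 4) (x : Pt) : ℝ :=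
  metric M a x (Pi.single i 1) (Pi.single j 1)

/-- The Christoffel symbols of the first kind
`Γ_{k,ij} = (∂_i g_{kj} + ∂_j g_{ki} - ∂_k g_{ij}) / 2`. -/
def christoffel (M a : ℝ) (k i j : Fin 4) (x : Pt) : ℝ :=
  (partialDeriv i (metricComp M a k j) x + partialDeriv j (metricComp M a k i) x
    - partialDeriv k (metricComp M a i j) x) / 2

/-- `γ` is an affinely parametrized geodesic of the Kerr exterior on the open set `J` of
parameters: the components `g_{kj} γ''^j + Γ_{k,ij} γ'^i γ'^j` of the covector `g ∇_{γ'} γ'`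
vanish (`g` being nondegenerate, this says that `∇_{γ'} γ' = 0`). -/
def IsGeodesicOn (M a : ℝ) (γ : ℝ → Pt) (J : Set ℝ) : Prop :=
  (∀ s ∈ J, γ s ∈ exterior M a) ∧ ContDiffOn ℝ 2 γ J ∧
    ∀ s ∈ J, ∀ k : Fin 4,
      ∑ j, metricComp M a k j (γ s) * deriv (deriv γ) s j
        + ∑ i, ∑ j, christoffel M a k i j (γ s) * deriv γ s i * deriv γ s j = 0

/-- The open interval `]s₋, s₊[`, with possibly infinite ends. -/
def interval (sm sp : EReal) : Set ℝ := {s : ℝ | sm < (s : EReal) ∧ (s : EReal) < sp}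

/-- The filter of the limit `s → s₋` from inside `]s₋, s₊[`. -/
def pastEnd (sm : EReal) : Filter ℝ := comap Real.toEReal (𝓝[>] sm)

/-- The filter of the limit `s → s₊` from inside `]s₋, s₊[`. -/
def futureEnd (sp : EReal) : Filter ℝ := comap Real.toEReal (𝓝[<] sp)

/-- `v` is null at `x`. -/
def IsNull (M a : ℝ) (x v : Pt) : Prop := v ≠ 0 ∧ metric M a x v v = 0

/-- `v` is timelike at `x`. -/
def IsTimelike (M a : ℝ) (x v : Pt) : Prop := metric M a x v v < 0

/-- A causal vector `v` at a point of the exterior is future directed, for the time orientation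
given by `-∇t`, if `g(-∇t, v) = -dt(v)` is negative. -/
def IsFutureDirected (v : Pt) : Prop := 0 < v 0

/-- `γ`, with parameter interval `]s₋, s₊[`, is a future directed null geodesic of the exterior
which is maximal in the exterior, i.e. is not the restriction of a geodesic of the exterior
defined on a larger interval. The values of `γ` outside `]s₋, s₊[` are irrelevant. -/
structure IsFutureNullGeodesic (M a : ℝ) (γ : ℝ → Pt) (sm sp : EReal) : Prop where
  lt : sm < sp
  geodesic : IsGeodesicOn M a γ (interval sm sp)
  null : ∀ s ∈ interval sm sp, IsNull M a (γ s) (deriv γ s)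
  future : ∀ s ∈ interval sm sp, IsFutureDirected (deriv γ s)
  maximal : ∀ (δ : ℝ → Pt) (um up : EReal), um ≤ sm → sp ≤ up →
    IsGeodesicOn M a δ (interval um up) → Set.EqOn δ γ (interval sm sp) → um = sm ∧ up = sp

/-- `γ` starts at `r₊`. -/
def StartsAtHorizon (M a : ℝ) (γ : ℝ → Pt) (sm : EReal) : Prop :=
  Tendsto (fun s => rad (γ s)) (pastEnd sm) (𝓝 (rPlus M a))

/-- `γ` starts at infinity. -/
def StartsAtInfinity (γ : ℝ → Pt) (sm : EReal) : Prop :=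
  Tendsto (fun s => rad (γ s)) (pastEnd sm) atTop

/-- The surface gravity `κ₊ = (r₊ - r₋) / (2 (r₊² + a²))`. -/
def kappaPlus (M a : ℝ) : ℝ := (rPlus M a - rMinus M a) / (2 * (rPlus M a ^ 2 + a ^ 2))

/-- `κ₋ = (r₋ - r₊) / (2 (r₋² + a²))`. -/
def kappaMinus (M a : ℝ) : ℝ := (rMinus M a - rPlus M a) / (2 * (rMinus M a ^ 2 + a ^ 2))

/-- `x(r) = r + ln |r - r₊| / (2 κ₊) + ln |r - r₋| / (2 κ₋)`. -/
def tortoise (M a r : ℝ) : ℝ :=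
  r + 1 / (2 * kappaPlus M a) * Real.log |r - rPlus M a|
    + 1 / (2 * kappaMinus M a) * Real.log |r - rMinus M a|

/-- The Kerr-star time `t* = t + x(r)`. -/
def tStar (M a : ℝ) (x : Pt) : ℝ := x 0 + tortoise M a (rad x)

/-- The vector field `∂_t`. -/
def dT : Pt := ![1, 0, 0, 0]

/-- The vector field `∂_r`. -/
def dR (x : Pt) : Pt := ![0, x 1 / rad x, x 2 / rad x, x 3 / rad x]

/-- The vector field `∂_φ`. -/
def dPhi (x : Pt) : Pt := ![0, -x 2, x 1, 0]

/-- The angular velocity `Ω_H = a / (r₊² + a²)` of the horizon. -/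
def omegaH (M a : ℝ) : ℝ := a / (rPlus M a ^ 2 + a ^ 2)

/-- The Killing field `v_I = ∂_t`. -/
def vI : Pt := dT

/-- The Killing field `v_H = ∂_t + Ω_H ∂_φ`. -/
def vH (M a : ℝ) (x : Pt) : Pt := dT + omegaH M a • dPhi x

/-- The first integral `E = -g(∂_t, v)`. -/
def energy (M a : ℝ) (x v : Pt) : ℝ := -metric M a x dT v

/-- The first integral `L = g(∂_φ, v)`. -/
def angMom (M a : ℝ) (x v : Pt) : ℝ := metric M a x (dPhi x) v

/-- The principal null directions `((r² + a²) / Δ) ∂_t ± ∂_r + (a / Δ) ∂_φ`, for `ε = ±1`. -/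
def principalNull (M a ε : ℝ) (x : Pt) : Pt :=
  ((rad x ^ 2 + a ^ 2) / Delta M a (rad x)) • dT + ε • dR x
    + (a / Delta M a (rad x)) • dPhi x

/-- The Carter constant `K = Δ g(l₊, v) g(l₋, v) + r² g(v, v)`, i.e. the value on `(v, v)` of the
Killing tensor of the Kerr metric; here `l₊`, `l₋` are the principal null directions. -/
def carterK (M a : ℝ) (x v : Pt) : ℝ :=
  Delta M a (rad x) * metric M a x (principalNull M a 1 x) v
      * metric M a x (principalNull M a (-1) x) v
    + rad x ^ 2 * metric M a x v v

/-- `Q = K - (L - a E)²`. -/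
def carterQ (M a : ℝ) (x v : Pt) : ℝ :=
  carterK M a x v - (angMom M a x v - a * energy M a x v) ^ 2

/-- `(E, L, Q)` are the first integrals of a null geodesic of `M_I` or `M_II`: as they are
constant along geodesics, they are read off from one tangent vector. -/
def AreNullIntegrals (M a E L Q : ℝ) : Prop :=
  ∃ x v : Pt, x ∈ exterior M a ∪ blockII M a ∧ IsNull M a x v ∧
    E = energy M a x v ∧ L = angMom M a x v ∧ Q = carterQ M a x v

/-- The radial potential `R(r) = P(r)² - Δ(r) K`, with `P(r) = (r² + a²) E - a L` and
`K = Q + (L - a E)²`. -/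
def radialPotential (M a E L Q r : ℝ) : ℝ :=
  ((r ^ 2 + a ^ 2) * E - a * L) ^ 2 - Delta M a r * (Q + (L - a * E) ^ 2)

/-- `r` is a double zero of the radial potential (a zero of order at least two). -/
def IsDoubleZero (M a E L Q r : ℝ) : Prop :=
  radialPotential M a E L Q r = 0 ∧ deriv (radialPotential M a E L Q) r = 0

end

end Kerr

/-!
Write `P(r) = (r² + a²) E - a L` and `w = ρ² r'`. A null geodesic satisfies `w² = R(r) = P² - Δ K`
and `ρ² w' = R'(r) / 2`. In Carter's canonical frame nullity bounds `|r'|` by a multiple of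
`(r - r₊) |t'|`. If `t` were bounded towards an end of a maximal geodesic, `log (r - r₊)` would
therefore be bounded, the orbit would stay in a compact shell, the affine parameter would be
infinite towards that end, and `|t'|` would be bounded below there: a contradiction.

At a zero of `R` outside the horizon `P² = Δ K`, and the constraints which the existence of a null
vector puts on `E`, `L` and `K` force `R'` to have the sign of `r - 3M` up to an error of order `a`.
Hence double zeros lie near `3M`, turning points below `2.9 M` are maxima of `r` and those above
`3.1 M` are minima. An orbit which avoids the intermediate region, where both Killing fields are
timelike, has at most one turning point, so `r` is eventually monotone in the past; unless the
orbit starts at the horizon or at infinity, `r` then converges to a double zero of `R` outside that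
region, which does not exist.
-/

namespace Kerr

noncomputable section

section Calculus

variable {E : Type*} [NormedAddCommGroup E] [NormedSpace ℝ E]

lemma deriv_deriv_eq_of_hasDerivAt {y v w : ℝ → E} {J : Set ℝ} (hJ : IsOpen J)
    (hy : ∀ s ∈ J, HasDerivAt y (v s) s) (hv : ∀ s ∈ J, HasDerivAt v (w s) s) {s : ℝ}
    (hs : s ∈ J) : deriv (deriv y) s = w s := by
  have hderiv : deriv y =ᶠ[𝓝 s] v :=
    eventually_of_mem (hJ.mem_nhds hs) fun u hu => (hy u hu).deriv
  rw [hderiv.deriv_eq, (hv s hs).deriv]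

lemma contDiffOn_two_of_hasDerivAt {y v w : ℝ → E} {J : Set ℝ} (hJ : IsOpen J)
    (hy : ∀ s ∈ J, HasDerivAt y (v s) s) (hv : ∀ s ∈ J, HasDerivAt v (w s) s)
    (hw : ContinuousOn w J) : ContDiffOn ℝ 2 y J := by
  have hv₁ : ContDiffOn ℝ 1 v J := (contDiffOn_succ_iff_deriv_of_isOpen (n := 0) hJ).2
    ⟨fun s hs => (hv s hs).differentiableAt.differentiableWithinAt, by simp,
      contDiffOn_zero.2 (hw.congr fun s hs => (hv s hs).deriv)⟩
  rw [← one_add_one_eq_two]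
  exact (contDiffOn_succ_iff_deriv_of_isOpen (n := 1) hJ).2
    ⟨fun s hs => (hy s hs).differentiableAt.differentiableWithinAt, by simp,
      hv₁.congr fun s hs => (hy s hs).deriv⟩

lemma exists_tendsto_left_of_norm_deriv_le [CompleteSpace E] {y y' : ℝ → E} {A a b : ℝ}
    (hab : a < b) (hy : ∀ s ∈ Set.Ioo a b, HasDerivAt y (y' s) s)
    (hA : ∀ s ∈ Set.Ioo a b, ‖y' s‖ ≤ A) : ∃ p, Tendsto y (𝓝[<] b) (𝓝 p) := by
  have hlip : LipschitzOnWith A.toNNReal y (Set.Ioo a b) :=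
    Convex.lipschitzOnWith_of_nnnorm_hasDerivWithin_le (convex_Ioo a b)
      (fun s hs => (hy s hs).hasDerivWithinAt)
      fun s hs => NNReal.coe_le_coe.1 ((hA s hs).trans (Real.le_coe_toNNReal A))
  exact CompleteSpace.complete ((cauchy_nhds.mono nhdsWithin_le_nhds).map_of_le
    hlip.uniformContinuousOn (le_principal_iff.2 (Ioo_mem_nhdsLT hab)))

lemma eventuallyEq_ite_of_lt {α : Type*} {y z : ℝ → α} {s b : ℝ} (hs : s < b) :
    (fun u => if u < b then y u else z u) =ᶠ[𝓝 s] y :=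
  eventually_of_mem (Iio_mem_nhds hs) fun _ hu => if_pos hu

lemma eventuallyEq_ite_of_gt {α : Type*} {y z : ℝ → α} {s b : ℝ} (hs : b < s) :
    (fun u => if u < b then y u else z u) =ᶠ[𝓝 s] z :=
  eventually_of_mem (Ioi_mem_nhds hs) fun _ hu => if_neg (not_lt_of_gt hu)

lemma hasDerivAt_ite_of_tendsto {F : E → E} {y z : ℝ → E} {a b : ℝ} (hab : a < b)
    (hy : ∀ s ∈ Set.Ioo a b, HasDerivAt y (F (y s)) s) (hz : HasDerivAt z (F (z b)) b)
    (hF : ContinuousAt F (z b)) (hlim : Tendsto y (𝓝[<] b) (𝓝 (z b))) :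
    HasDerivAt (fun s => if s < b then y s else z s) (F (z b)) b := by
  set w : ℝ → E := fun s => if s < b then y s else z s
  have hwb : w b = z b := if_neg (lt_irrefl b)
  have hw : ∀ s ∈ Set.Ioo a b, HasDerivAt w (F (y s)) s := fun s hs =>
    (hy s hs).congr_of_eventuallyEq (eventuallyEq_ite_of_lt hs.2)
  have hleft : HasDerivWithinAt w (F (z b)) (Set.Iic b) b := by
    refine hasDerivWithinAt_Iic_of_tendsto_deriv (s := Set.Ioo a b)
      (fun s hs => (hw s hs).differentiableAt.differentiableWithinAt) ?_ (Ioo_mem_nhdsLT hab) ?_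
    · rw [ContinuousWithinAt, hwb]
      refine (hlim.mono_left (nhdsWithin_mono _ fun s hs => hs.2)).congr' ?_
      filter_upwards [self_mem_nhdsWithin] with s hs using (if_pos hs.2).symm
    · refine (hF.tendsto.comp hlim).congr' ?_
      filter_upwards [Ioo_mem_nhdsLT hab] with s hs using (hw s hs).deriv.symm
  have hright : HasDerivWithinAt w (F (z b)) (Set.Ici b) b :=
    hz.hasDerivWithinAt.congr (fun s hs => if_neg (not_lt_of_ge hs)) hwb
  simpa only [Set.Iic_union_Ici, hasDerivWithinAt_univ] using hleft.union hright

/-- The solution converges at the end of its interval, where it can be restarted. -/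
theorem exists_solution_extension [CompleteSpace E] {F : E → E} {U C : Set E} (hU : IsOpen U)
    (hF : ContDiffOn ℝ 1 F U) (hC : IsCompact C) (hCU : C ⊆ U) {y : ℝ → E} {a b : ℝ} (hab : a < b)
    (hy : ∀ s ∈ Set.Ioo a b, HasDerivAt y (F (y s)) s) (hyC : ∀ s ∈ Set.Ioo a b, y s ∈ C) :
    ∃ c > b, ∃ z : ℝ → E, (∀ s ∈ Set.Ioo a c, z s ∈ U ∧ HasDerivAt z (F (z s)) s) ∧
      Set.EqOn z y (Set.Ioo a b) := by
  obtain ⟨A, hA⟩ := hC.exists_bound_of_continuousOn (hF.continuousOn.mono hCU)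
  obtain ⟨p, hp⟩ := exists_tendsto_left_of_norm_deriv_le hab hy fun s hs => hA _ (hyC s hs)
  have hpC : p ∈ C :=
    hC.isClosed.mem_of_tendsto hp (mem_of_superset (Ioo_mem_nhdsLT hab) hyC)
  have hFp : ContDiffAt ℝ 1 F p := hF.contDiffAt (hU.mem_nhds (hCU hpC))
  obtain ⟨α, rfl, ε, hε, hα⟩ :=
    hFp.exists_forall_mem_closedBall_exists_eq_forall_mem_Ioo_hasDerivAt₀ b
  have hαb : HasDerivAt α (F (α b)) b := hα b ⟨by linarith, by linarith⟩
  obtain ⟨c, hbc, hcU⟩ : ∃ c > b, ∀ s ∈ Set.Ico b c, α s ∈ U ∧ HasDerivAt α (F (α s)) s := by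
    have hev : ∀ᶠ s in 𝓝[≥] b, α s ∈ U ∧ HasDerivAt α (F (α s)) s :=
      nhdsWithin_le_nhds ((hαb.continuousAt.eventually_mem (hU.mem_nhds (hCU hpC))).and
        (mem_of_superset (Ioo_mem_nhds (by linarith) (by linarith)) hα))
    exact (mem_nhdsGE_iff_exists_Ico_subset).1 hev
  refine ⟨c, hbc, fun s => if s < b then y s else α s, fun s hs => ?_, fun s hs => if_pos hs.2⟩
  rcases lt_trichotomy s b with hsb | rfl | hsb
  · simp only [if_pos hsb]
    exact ⟨hCU (hyC s ⟨hs.1, hsb⟩),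
      (hy s ⟨hs.1, hsb⟩).congr_of_eventuallyEq (eventuallyEq_ite_of_lt hsb)⟩
  · simp only [if_neg (lt_irrefl s)]
    exact ⟨hCU hpC, hasDerivAt_ite_of_tendsto hab hy hαb hFp.continuousAt hp⟩
  · simp only [if_neg hsb.not_gt]
    obtain ⟨hαU, hαs⟩ := hcU s ⟨hsb.le, hs.2⟩
    exact ⟨hαU, hαs.congr_of_eventuallyEq (eventuallyEq_ite_of_gt hsb)⟩

lemma neg_of_deriv_neg_at_zeros {f f' : ℝ → ℝ} {a b : ℝ} (hab : a < b)
    (hf : ∀ s ∈ Set.Icc a b, HasDerivAt f (f' s) s)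
    (hneg : ∀ s ∈ Set.Icc a b, f s = 0 → f' s < 0) (ha : f a = 0) : f b < 0 := by
  have hle : ∀ ⦃s⦄, s ∈ Set.Icc a b → f s ≤ 0 :=
    image_le_of_deriv_right_lt_deriv_boundary (B := fun _ => 0) (B' := fun _ => 0)
      (fun s hs => (hf s hs).continuousAt.continuousWithinAt)
      (fun s hs => (hf s (Set.Ico_subset_Icc_self hs)).hasDerivWithinAt) ha.le
      (fun s => hasDerivAt_const s 0) fun s hs => hneg s (Set.Ico_subset_Icc_self hs)
  have hbI : b ∈ Set.Icc a b := Set.right_mem_Icc.2 hab.le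
  refine (hle hbI).lt_of_ne fun hb => ?_
  have hslope : ∀ᶠ s in 𝓝[<] b, slope f b s < 0 :=
    (hasDerivAt_iff_tendsto_slope_left_right.1 (hf b hbI)).1.eventually_lt_const (hneg b hbI hb)
  obtain ⟨s, hs, hsab⟩ := (hslope.and (Ioo_mem_nhdsLT hab)).exists
  rw [slope_def_field, hb, sub_zero] at hs
  exact hs.not_ge (div_nonneg_of_nonpos (hle (Set.Ioo_subset_Icc_self hsab)) (by linarith [hsab.2]))

lemma exists_sign_of_eq_zero_unique {f : ℝ → ℝ} {J : Set ℝ} (hJ : J.OrdConnected)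
    (hne : J.Nonempty) (hf : ContinuousOn f J)
    (huniq : ∀ a ∈ J, ∀ b ∈ J, a < b → f a = 0 → f b ≠ 0) :
    ∃ s₁ ∈ J, (∀ s ∈ J, s < s₁ → 0 < f s) ∨ (∀ s ∈ J, s < s₁ → f s < 0) := by
  obtain ⟨s₁, hs₁, hne₀⟩ : ∃ s₁ ∈ J, ∀ s ∈ J, s < s₁ → f s ≠ 0 := by
    by_cases! hz : ∃ s ∈ J, f s = 0
    · obtain ⟨s₁, hs₁, hfs₁⟩ := hz
      exact ⟨s₁, hs₁, fun s hs hlt hfs => huniq s hs s₁ hs₁ hlt hfs hfs₁⟩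
    · obtain ⟨s₁, hs₁⟩ := hne
      exact ⟨s₁, hs₁, fun s hs _ => hz s hs⟩
  refine ⟨s₁, hs₁, ?_⟩
  by_contra! hcon
  obtain ⟨⟨u, hu, hus, hfu⟩, w, hw, hws, hfw⟩ := hcon
  have hsub : Set.uIcc u w ⊆ J := hJ.uIcc_subset hu hw
  obtain ⟨c, hc, hc₀⟩ :=
    intermediate_value_uIcc (hf.mono hsub) (Set.mem_uIcc.2 (.inl ⟨hfu, hfw⟩))
  exact hne₀ c (hsub hc) (hc.2.trans_lt (max_lt hus hws)) hc₀

lemma exists_lt_of_le_deriv {f f' : ℝ → ℝ} {c s₁ : ℝ} (hc : 0 < c)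
    (hf : ∀ s < s₁, HasDerivAt f (f' s) s) (hf' : ∀ s < s₁, c ≤ f' s) (B : ℝ) :
    ∃ s < s₁, f s < B := by
  set u := s₁ - 1
  have hmean : ∀ w < u, c * (u - w) ≤ f u - f w := fun w hwu =>
    (convex_Iio s₁).mul_sub_le_image_sub_of_le_deriv
      (fun s hs => (hf s hs).continuousAt.continuousWithinAt)
      (by
        rw [interior_Iio]
        exact fun s hs => (hf s hs).differentiableAt.differentiableWithinAt)
      (by
        rw [interior_Iio]
        exact fun s hs => (hf s hs).deriv ▸ hf' s hs)
      w (hwu.trans (sub_one_lt s₁)) u (sub_one_lt s₁) hwu.le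
  have hlim : Tendsto (fun w => c * (u - w)) atBot atTop :=
    (tendsto_atTop_add_const_left _ u tendsto_neg_atBot_atTop).const_mul_atTop hc
  obtain ⟨w, hw, hwu⟩ :=
    ((hlim.eventually_gt_atTop (f u - B)).and (eventually_lt_atBot u)).exists
  exact ⟨w, hwu.trans (sub_one_lt s₁), by linarith [hmean w hwu]⟩

lemma norm_sub_le_sub_of_norm_deriv_le {f f' : ℝ → E} {B B' : ℝ → ℝ} {J : Set ℝ}
    (hJ : J.OrdConnected) (hf : ∀ s ∈ J, HasDerivAt f (f' s) s)
    (hB : ∀ s ∈ J, HasDerivAt B (B' s) s) (hle : ∀ s ∈ J, ‖f' s‖ ≤ B' s) {a b : ℝ} (ha : a ∈ J)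
    (hb : b ∈ J) (hab : a ≤ b) : ‖f b - f a‖ ≤ B b - B a := by
  have hsub : Set.Icc a b ⊆ J := hJ.out ha hb
  refine image_norm_le_of_norm_deriv_right_le_deriv_boundary' (f := fun s => f s - f a)
    (B := fun s => B s - B a)
    (fun s hs => ((hf s (hsub hs)).sub_const _).continuousAt.continuousWithinAt)
    (fun s hs => ((hf s (hsub (Set.Ico_subset_Icc_self hs))).sub_const _).hasDerivWithinAt)
    (by simp) (fun s hs => ((hB s (hsub hs)).sub_const _).continuousAt.continuousWithinAt)
    (fun s hs => ((hB s (hsub (Set.Ico_subset_Icc_self hs))).sub_const _).hasDerivWithinAt)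
    (fun s hs => hle s (hsub (Set.Ico_subset_Icc_self hs))) (Set.right_mem_Icc.2 hab)

lemma eq_zero_of_tendsto_of_hasDerivAt_div {f g ρ : ℝ → ℝ} {s₂ N F G : ℝ}
    (hf : ∀ s ≤ s₂, HasDerivAt f (g s / ρ s) s) (hρ : ∀ s ≤ s₂, 0 < ρ s ∧ ρ s ≤ N)
    (hF : Tendsto f atBot (𝓝 F)) (hG : Tendsto g atBot (𝓝 G)) : G = 0 := by
  wlog hpos : 0 < G generalizing f g F G
  · by_contra hne
    refine neg_ne_zero.2 hne (this (f := fun s => -f s) (g := fun s => -g s)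
      (fun s hs => ?_) hF.neg hG.neg (neg_pos.2 ((not_lt.1 hpos).lt_of_ne hne)))
    rw [neg_div]
    exact (hf s hs).fun_neg
  have hN : 0 < N := (hρ s₂ le_rfl).1.trans_le (hρ s₂ le_rfl).2
  obtain ⟨s₁, hs₁⟩ := eventually_atBot.1 ((hG.eventually_const_lt (half_lt_self hpos)).and
    ((hF.eventually_const_lt (sub_one_lt F)).and (eventually_le_atBot s₂)))
  have hgrowth : ∀ s < s₁, G / 2 / N ≤ g s / ρ s := fun s hs => by
    obtain ⟨hg, -, hs₂⟩ := hs₁ s hs.le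
    obtain ⟨hρ₀, hρN⟩ := hρ s hs₂
    gcongr
    exact (half_pos hpos).le.trans hg.le
  obtain ⟨s, hs, hlt⟩ := exists_lt_of_le_deriv (div_pos (half_pos hpos) hN)
    (fun s hs => hf s (hs₁ s hs.le).2.2) hgrowth (F - 1)
  exact absurd (hs₁ s hs.le).2.1 hlt.not_gt

lemma exists_tendsto_atBot_of_monotoneOn {f : ℝ → ℝ} {s₂ m : ℝ}
    (hf : MonotoneOn f (Set.Iic s₂)) (hm : ∀ s ≤ s₂, m ≤ f s) :
    ∃ l, Tendsto f atBot (𝓝 l) := by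
  have hmono : Monotone fun s => f (min s s₂) := fun u w huw =>
    hf (Set.mem_Iic.2 (min_le_right u s₂)) (Set.mem_Iic.2 (min_le_right w s₂))
      (min_le_min_right s₂ huw)
  refine ⟨_, (tendsto_atBot_ciInf hmono ⟨m, ?_⟩).congr' ?_⟩
  · exact Set.forall_mem_range.2 fun s => hm _ (min_le_right _ _)
  · filter_upwards [eventually_le_atBot s₂] with s hs
    rw [min_eq_left hs]

lemma forall_le_or_forall_ge_of_notMem_Ioo {f : ℝ → ℝ} {J : Set ℝ} {b c : ℝ}
    (hJ : IsPreconnected J) (hf : ContinuousOn f J) (hbc : b < c)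
    (hout : ∀ s ∈ J, f s ∉ Set.Ioo b c) : (∀ s ∈ J, f s ≤ b) ∨ ∀ s ∈ J, c ≤ f s := by
  by_contra! hcon
  obtain ⟨⟨u, hu, hbu⟩, w, hw, hwc⟩ := hcon
  have hcu : c ≤ f u := not_lt.1 fun hlt => hout u hu ⟨hbu, hlt⟩
  have hwb : f w ≤ b := not_lt.1 fun hlt => hout w hw ⟨hlt, hwc⟩
  obtain ⟨m, hbm, hmc⟩ := exists_between hbc
  obtain ⟨s, hs, rfl⟩ :=
    hJ.intermediate_value hw hu hf ⟨hwb.trans hbm.le, hmc.le.trans hcu⟩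
  exact hout s hs ⟨hbm, hmc⟩

end Calculus

section Horizon

variable {M a r : ℝ}

lemma pos_of_abs_lt (h : |a| < M) : 0 < M := (abs_nonneg a).trans_lt h

lemma sqrt_sq_sub_sq_pos (h : |a| < M) : 0 < √(M ^ 2 - a ^ 2) :=
  Real.sqrt_pos.2 (sub_pos.2 (sq_lt_sq.2 (h.trans_le (le_abs_self M))))

lemma sqrt_sq_sub_sq_le (hM : 0 ≤ M) : √(M ^ 2 - a ^ 2) ≤ M :=
  Real.sqrt_le_iff.2 ⟨hM, sub_le_self _ (sq_nonneg a)⟩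

lemma rMinus_nonneg (hM : 0 ≤ M) : 0 ≤ rMinus M a := sub_nonneg.2 (sqrt_sq_sub_sq_le hM)

lemma rMinus_pos (ha : a ≠ 0) (h : |a| < M) : 0 < rMinus M a := by
  rw [rMinus, sub_pos, Real.sqrt_lt' (pos_of_abs_lt h)]
  exact sub_lt_self _ (by positivity)

lemma rMinus_lt (h : |a| < M) : rMinus M a < M := sub_lt_self _ (sqrt_sq_sub_sq_pos h)

lemma lt_rPlus (h : |a| < M) : M < rPlus M a := lt_add_of_pos_right _ (sqrt_sq_sub_sq_pos h)

lemma rMinus_lt_rPlus (h : |a| < M) : rMinus M a < rPlus M a := (rMinus_lt h).trans (lt_rPlus h)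

lemma rPlus_pos (h : |a| < M) : 0 < rPlus M a := (pos_of_abs_lt h).trans (lt_rPlus h)

lemma rPlus_le (hM : 0 ≤ M) : rPlus M a ≤ 2 * M := by
  rw [rPlus, two_mul]
  exact add_le_add_right (sqrt_sq_sub_sq_le hM) M

lemma Delta_eq_mul (h : |a| < M) (r : ℝ) :
    Delta M a r = (r - rPlus M a) * (r - rMinus M a) := by
  have hsq : √(M ^ 2 - a ^ 2) ^ 2 = M ^ 2 - a ^ 2 :=
    Real.sq_sqrt (sub_pos.2 (sq_lt_sq.2 (h.trans_le (le_abs_self M)))).le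
  unfold Delta rPlus rMinus
  linear_combination hsq

lemma Delta_pos (h : |a| < M) (hr : rPlus M a < r) : 0 < Delta M a r := by
  rw [Delta_eq_mul h]
  exact mul_pos (sub_pos.2 hr) (sub_pos.2 ((rMinus_lt_rPlus h).trans hr))

lemma Delta_neg (h : |a| < M) (h₁ : rMinus M a < r) (h₂ : r < rPlus M a) : Delta M a r < 0 := by
  rw [Delta_eq_mul h]
  exact mul_neg_of_neg_of_pos (sub_neg.2 h₂) (sub_pos.2 h₁)

lemma Delta_le_Delta {r₁ : ℝ} (h₁ : M ≤ r₁) (h : r₁ ≤ r) : Delta M a r₁ ≤ Delta M a r := by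
  rw [Delta, Delta]
  nlinarith

lemma hasDerivAt_Delta (M a r : ℝ) : HasDerivAt (Delta M a) (2 * (r - M)) r := by
  have h := ((hasDerivAt_pow 2 r).sub ((hasDerivAt_id r).const_mul (2 * M))).add_const (a ^ 2)
  exact h.congr_deriv (by push_cast; ring)

end Horizon

section Coordinates

variable {x : Pt}

lemma rad_sq (x : Pt) : rad x ^ 2 = x 1 ^ 2 + x 2 ^ 2 + x 3 ^ 2 :=
  Real.sq_sqrt (by positivity)

/-- `sin² θ`, as a function on the Cartesian chart. -/
def sinSqTheta (x : Pt) : ℝ := 1 - cosTheta x ^ 2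

lemma cosTheta_sq_le_one (x : Pt) : cosTheta x ^ 2 ≤ 1 := by
  rw [cosTheta, div_pow]
  refine div_le_one_of_le₀ ?_ (sq_nonneg _)
  rw [rad_sq]
  exact le_add_of_nonneg_left (by positivity)

lemma sinSqTheta_nonneg (x : Pt) : 0 ≤ sinSqTheta x := sub_nonneg.2 (cosTheta_sq_le_one x)

lemma sinSqTheta_le_one (x : Pt) : sinSqTheta x ≤ 1 := sub_le_self _ (sq_nonneg _)

lemma rhoSq_pos (a : ℝ) (hr : 0 < rad x) : 0 < rhoSq a x := by
  unfold rhoSq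
  positivity

lemma rad_sq_le_rhoSq (a : ℝ) (x : Pt) : rad x ^ 2 ≤ rhoSq a x :=
  le_add_of_nonneg_right (mul_nonneg (sq_nonneg a) (sq_nonneg _))

lemma rhoSq_le (a : ℝ) (x : Pt) : rhoSq a x ≤ rad x ^ 2 + a ^ 2 :=
  add_le_add_right (mul_le_of_le_one_right (sq_nonneg a) (cosTheta_sq_le_one x)) _

lemma rhoSq_add_sq_mul_sinSqTheta (a : ℝ) (x : Pt) :
    rhoSq a x + a ^ 2 * sinSqTheta x = rad x ^ 2 + a ^ 2 := by
  rw [rhoSq, sinSqTheta]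
  ring

lemma sphereMetric_self_nonneg (x v : Pt) : 0 ≤ sphereMetric x v v := by
  rcases eq_or_ne (rad x) 0 with h0 | h0
  · simp [sphereMetric, h0]
  have lagrange : sphereMetric x v v = ((x 1 * v 2 - x 2 * v 1) ^ 2
      + (x 2 * v 3 - x 3 * v 2) ^ 2 + (x 3 * v 1 - x 1 * v 3) ^ 2) / rad x ^ 4 := by
    simp only [sphereMetric, dr]
    field_simp
    rw [rad_sq]
    ring
  rw [lagrange]
  positivity

/-- The difference of the two sides is `(d cos θ)²`. -/
lemma sinSqDphi_sq_le (hr : 0 < rad x) (v : Pt) :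
    sinSqDphi x v ^ 2 ≤ sinSqTheta x * sphereMetric x v v := by
  have hsq : sinSqTheta x * sphereMetric x v v - sinSqDphi x v ^ 2
      = ((v 3 - cosTheta x * dr x v) / rad x) ^ 2 := by
    have h := rad_sq x
    simp only [sinSqTheta, sphereMetric, sinSqDphi, dr, cosTheta]
    field_simp
    generalize rad x = r at h ⊢
    have hx3 : x 3 ^ 2 = r ^ 2 - x 1 ^ 2 - x 2 ^ 2 := by linarith
    ring_nf
    rw [show x 3 ^ 4 = (x 3 ^ 2) ^ 2 by ring, show x 3 ^ 3 = x 3 ^ 2 * x 3 by ring, hx3]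
    ring
  exact sub_nonneg.1 (hsq ▸ sq_nonneg _)

lemma sq_add_sq_add_sq_eq (hr : 0 < rad x) (v : Pt) :
    v 1 ^ 2 + v 2 ^ 2 + v 3 ^ 2 = dr x v ^ 2 + rad x ^ 2 * sphereMetric x v v := by
  rw [sphereMetric]
  field_simp
  ring

lemma eq_zero_of_dr_eq_zero_of_sphereMetric_eq_zero {v : Pt} (hr : 0 < rad x) (h₀ : v 0 = 0)
    (hdr : dr x v = 0) (hS : sphereMetric x v v = 0) : v = 0 := by
  have hsum := sq_add_sq_add_sq_eq hr v
  rw [hdr, hS] at hsum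
  ext i
  fin_cases i
  · exact h₀
  all_goals
    refine pow_eq_zero_iff two_ne_zero |>.1 (le_antisymm ?_ (sq_nonneg _))
    simp only [Fin.reduceFinMk]
    nlinarith [sq_nonneg (v 1), sq_nonneg (v 2), sq_nonneg (v 3)]

end Coordinates

section Metric

variable {M a : ℝ} {x v : Pt}

lemma metric_smul_add_left (M a k : ℝ) (x u w v : Pt) :
    metric M a x (k • u + w) v = k * metric M a x u v + metric M a x w v := by
  simp only [metric, sphereMetric, sinSqDphi, dr, Pi.add_apply, Pi.smul_apply, smul_eq_mul]
  ring

lemma metric_comm (M a : ℝ) (x v w : Pt) : metric M a x v w = metric M a x w v := by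
  simp only [metric, sphereMetric]
  ring

lemma metric_neg_neg (M a : ℝ) (x v w : Pt) : metric M a x (-v) (-w) = metric M a x v w := by
  simp only [metric, sphereMetric, sinSqDphi, dr, Pi.neg_apply]
  ring

lemma metric_dT (M a : ℝ) (x v : Pt) :
    metric M a x dT v = -(1 - 2 * M * rad x / rhoSq a x) * v 0
      - 2 * a * M * rad x / rhoSq a x * sinSqDphi x v := by
  simp [metric, sphereMetric, sinSqDphi, dr, dT]

lemma sinSqDphi_dPhi (hr : 0 < rad x) : sinSqDphi x (dPhi x) = sinSqTheta x := by
  simp only [sinSqDphi, dPhi, sinSqTheta, cosTheta, Matrix.cons_val]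
  field_simp
  linear_combination -rad_sq x

lemma dr_dPhi (x : Pt) : dr x (dPhi x) = 0 := by
  simp only [dr, dPhi, Matrix.cons_val]
  ring

lemma sphereMetric_dPhi (x v : Pt) : sphereMetric x (dPhi x) v = sinSqDphi x v := by
  rw [sphereMetric, dr_dPhi]
  simp only [sinSqDphi, dPhi, Matrix.cons_val]
  ring

lemma metric_dPhi (M a : ℝ) (hr : 0 < rad x) (v : Pt) :
    metric M a x (dPhi x) v = -(2 * a * M * rad x / rhoSq a x * sinSqTheta x) * v 0
      + (rhoSq a x + a ^ 2 * (1 + 2 * M * rad x / rhoSq a x) * sinSqTheta x)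
        * sinSqDphi x v := by
  rw [metric, sphereMetric_dPhi, dr_dPhi, sinSqDphi_dPhi hr]
  simp only [dPhi, Matrix.cons_val]
  ring

lemma metric_dR (M a : ℝ) (hr : 0 < rad x) (v : Pt) :
    metric M a x (dR x) v = rhoSq a x / Delta M a (rad x) * dr x v := by
  have hdr : dr x (dR x) = 1 := by
    simp only [dr, dR, Matrix.cons_val]
    field_simp
    linear_combination -rad_sq x
  have hφ : sinSqDphi x (dR x) = 0 := by
    simp only [sinSqDphi, dR, Matrix.cons_val]
    ring
  have hS : sphereMetric x (dR x) v = 0 := by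
    rw [sphereMetric, hdr]
    simp only [dR, dr, Matrix.cons_val]
    ring
  rw [metric, hdr, hφ, hS]
  simp only [dR, Matrix.cons_val]
  ring

/-- The one-form `dt - a sin² θ dφ` of Carter's canonical frame. -/
def carterForm (a : ℝ) (x v : Pt) : ℝ := v 0 - a * sinSqDphi x v

/-- The one-form `sin² θ ((r² + a²) dφ - a dt)`, a multiple of the azimuthal form of Carter's
canonical frame which is smooth across the axis. -/
def azimuthalForm (a : ℝ) (x v : Pt) : ℝ :=
  (rad x ^ 2 + a ^ 2) * sinSqDphi x v - a * sinSqTheta x * v 0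

/-- The radial momentum `ρ² r'`. -/
def radialMomentum (a : ℝ) (x v : Pt) : ℝ := rhoSq a x * dr x v

/-- The quadratic form `ρ⁴ dθ² + (sin² θ ((r² + a²) dφ - a dt))² / sin² θ`, multiplied out so that
nothing is divided by `sin² θ`, which vanishes on the axis. -/
def angularForm (a : ℝ) (x v : Pt) : ℝ :=
  rhoSq a x ^ 2 * sphereMetric x v v - 2 * a * rhoSq a x * sinSqDphi x v * carterForm a x v
    + a ^ 2 * sinSqTheta x * carterForm a x v ^ 2

lemma rhoSq_mul_time (a : ℝ) (x v : Pt) :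
    rhoSq a x * v 0 = (rad x ^ 2 + a ^ 2) * carterForm a x v + a * azimuthalForm a x v := by
  rw [carterForm, azimuthalForm]
  linear_combination v 0 * rhoSq_add_sq_mul_sinSqTheta a x

lemma azimuthalForm_eq (a : ℝ) (x v : Pt) :
    azimuthalForm a x v = rhoSq a x * sinSqDphi x v - a * sinSqTheta x * carterForm a x v := by
  rw [carterForm, azimuthalForm]
  linear_combination -sinSqDphi x v * rhoSq_add_sq_mul_sinSqTheta a x

lemma rhoSq_mul_metric (hr : 0 < rad x) (hΔ : Delta M a (rad x) ≠ 0) (v : Pt) :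
    rhoSq a x * metric M a x v v = -Delta M a (rad x) * carterForm a x v ^ 2
      + radialMomentum a x v ^ 2 / Delta M a (rad x) + angularForm a x v := by
  have hρ := (rhoSq_pos a hr).ne'
  have hs := rhoSq_add_sq_mul_sinSqTheta a x
  have hD : Delta M a (rad x) = rad x ^ 2 - 2 * M * rad x + a ^ 2 := rfl
  rw [metric, radialMomentum, angularForm, carterForm]
  field_simp
  generalize Delta M a (rad x) = D at *
  generalize rhoSq a x = ρ at *
  obtain rfl : ρ = rad x ^ 2 + a ^ 2 - a ^ 2 * sinSqTheta x := by linarith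
  rw [hD]
  ring

lemma azimuthalForm_sq_le_mul_angularForm (hr : 0 < rad x) (v : Pt) :
    azimuthalForm a x v ^ 2 ≤ sinSqTheta x * angularForm a x v := by
  have hsq : sinSqTheta x * angularForm a x v - azimuthalForm a x v ^ 2
      = rhoSq a x ^ 2 * (sinSqTheta x * sphereMetric x v v - sinSqDphi x v ^ 2) := by
    rw [azimuthalForm_eq, angularForm]
    ring
  exact sub_nonneg.1 (hsq ▸ mul_nonneg (sq_nonneg _) (sub_nonneg.2 (sinSqDphi_sq_le hr v)))

lemma angularForm_nonneg (a : ℝ) (hr : 0 < rad x) (v : Pt) : 0 ≤ angularForm a x v := by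
  rcases (sinSqTheta_nonneg x).eq_or_lt with hs | hs
  · have hφ : sinSqDphi x v = 0 := by
      have h := sinSqDphi_sq_le hr v
      rw [← hs, zero_mul] at h
      exact pow_eq_zero_iff two_ne_zero |>.1 (le_antisymm h (sq_nonneg _))
    rw [angularForm, hφ, ← hs]
    simpa using mul_nonneg (sq_nonneg (rhoSq a x)) (sphereMetric_self_nonneg x v)
  · exact nonneg_of_mul_nonneg_right
      ((sq_nonneg _).trans (azimuthalForm_sq_le_mul_angularForm hr v)) hs

end Metric

section FirstIntegrals

/-- The function `P(r) = (r² + a²) E - a L` whose square is the leading term of the radial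
potential. -/
def radialP (a E L r : ℝ) : ℝ := (r ^ 2 + a ^ 2) * E - a * L

variable {M a : ℝ} {x v : Pt}

lemma radialP_energy_angMom (M a : ℝ) (hr : 0 < rad x) (v : Pt) :
    radialP a (energy M a x v) (angMom M a x v) (rad x)
      = Delta M a (rad x) * carterForm a x v := by
  have hρ := rhoSq_pos a hr
  rw [radialP, energy, angMom, metric_dT, metric_dPhi M a hr, carterForm]
  field_simp
  rw [rhoSq, Delta, sinSqTheta]
  ring

lemma angMom_sub_energy_mul_sinSqTheta (M a : ℝ) (hr : 0 < rad x) (v : Pt) :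
    angMom M a x v - a * energy M a x v * sinSqTheta x = azimuthalForm a x v := by
  have hρ := rhoSq_pos a hr
  rw [energy, angMom, metric_dT, metric_dPhi M a hr, azimuthalForm]
  field_simp
  rw [rhoSq, sinSqTheta]
  ring

lemma metric_principalNull (M a ε : ℝ) (hr : 0 < rad x) (v : Pt) :
    metric M a x (principalNull M a ε x) v
      = (-radialP a (energy M a x v) (angMom M a x v) (rad x) + ε * radialMomentum a x v)
        / Delta M a (rad x) := by
  have hl : principalNull M a ε x = ((rad x ^ 2 + a ^ 2) / Delta M a (rad x)) • dT
      + (ε • dR x + ((a / Delta M a (rad x)) • dPhi x + 0)) := by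
    simp [principalNull, add_assoc]
  have h0 : metric M a x 0 v = 0 := by simp [metric, sphereMetric, sinSqDphi, dr]
  rw [hl, metric_smul_add_left, metric_smul_add_left, metric_smul_add_left, h0, metric_dR M a hr,
    radialP, energy, angMom, radialMomentum]
  ring

lemma Delta_mul_carterK (hr : 0 < rad x) (hΔ : Delta M a (rad x) ≠ 0)
    (hn : metric M a x v v = 0) :
    Delta M a (rad x) * carterK M a x v
      = radialP a (energy M a x v) (angMom M a x v) (rad x) ^ 2 - radialMomentum a x v ^ 2 := by
  rw [carterK, metric_principalNull M a 1 hr, metric_principalNull M a (-1) hr, hn]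
  field_simp
  ring

lemma carterK_eq_angularForm (hr : 0 < rad x) (hΔ : Delta M a (rad x) ≠ 0)
    (hn : metric M a x v v = 0) : carterK M a x v = angularForm a x v := by
  have hK := Delta_mul_carterK hr hΔ hn
  have hg := rhoSq_mul_metric hr hΔ v
  rw [radialP_energy_angMom M a hr] at hK
  rw [hn] at hg
  field_simp at hg
  refine mul_left_cancel₀ hΔ ?_
  linear_combination hK + hg

lemma carterK_nonneg (hr : 0 < rad x) (hΔ : Delta M a (rad x) ≠ 0) (hn : metric M a x v v = 0) :
    0 ≤ carterK M a x v :=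
  carterK_eq_angularForm hr hΔ hn ▸ angularForm_nonneg a hr v

lemma azimuthalForm_sq_le_carterK_mul (hr : 0 < rad x) (hΔ : Delta M a (rad x) ≠ 0)
    (hn : metric M a x v v = 0) :
    azimuthalForm a x v ^ 2 ≤ carterK M a x v * sinSqTheta x := by
  rw [carterK_eq_angularForm hr hΔ hn, mul_comm]
  exact azimuthalForm_sq_le_mul_angularForm hr v

lemma eq_zero_of_integrals_eq_zero (hr : 0 < rad x) (hΔ : Delta M a (rad x) ≠ 0)
    (hn : metric M a x v v = 0) (hE : energy M a x v = 0) (hL : angMom M a x v = 0)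
    (hK : carterK M a x v = 0) : v = 0 := by
  have hρ := (rhoSq_pos a hr).ne'
  have hP : radialP a (energy M a x v) (angMom M a x v) (rad x) = 0 := by
    rw [hE, hL, radialP]
    ring
  have hτ : carterForm a x v = 0 :=
    (mul_eq_zero.1 (radialP_energy_angMom M a hr v ▸ hP)).resolve_left hΔ
  have hdr : dr x v = 0 := by
    have h := Delta_mul_carterK hr hΔ hn
    rw [hK, hP] at h
    have hp : radialMomentum a x v = 0 := pow_eq_zero_iff two_ne_zero |>.1 (by linarith)
    exact (mul_eq_zero.1 hp).resolve_left hρ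
  have hS : sphereMetric x v v = 0 := by
    have h := carterK_eq_angularForm hr hΔ hn
    rw [hK, angularForm, hτ] at h
    exact (mul_eq_zero.1 (show rhoSq a x ^ 2 * sphereMetric x v v = 0 by linarith)).resolve_left
      (pow_ne_zero 2 hρ)
  have hφ : sinSqDphi x v = 0 := by
    have h := sinSqDphi_sq_le hr v
    rw [hS, mul_zero] at h
    exact pow_eq_zero_iff two_ne_zero |>.1 (le_antisymm h (sq_nonneg _))
  refine eq_zero_of_dr_eq_zero_of_sphereMetric_eq_zero hr ?_ hdr hS
  rwa [carterForm, hφ, mul_zero, sub_zero] at hτ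

/-- The constraints which the existence of a null vector at a point of a Kerr block puts on the
values of `E`, `L` and the Carter constant `K`. The number `σ` is the value of `sin² θ` at that
point. -/
structure AdmissibleIntegrals (a E L K : ℝ) : Prop where
  carter_nonneg : 0 ≤ K
  energy_ne_zero : K = 0 → E ≠ 0
  exists_sinSq : ∃ σ, 0 ≤ σ ∧ σ ≤ 1 ∧ (L - a * E * σ) ^ 2 ≤ K * σ

lemma IsNull.admissibleIntegrals (hn : IsNull M a x v) (hr : 0 < rad x)
    (hΔ : Delta M a (rad x) ≠ 0) :
    AdmissibleIntegrals a (energy M a x v) (angMom M a x v) (carterK M a x v) where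
  carter_nonneg := carterK_nonneg hr hΔ hn.2
  energy_ne_zero := by
    intro hK hE
    have h := azimuthalForm_sq_le_carterK_mul hr hΔ hn.2
    rw [hK, zero_mul, ← angMom_sub_energy_mul_sinSqTheta M a hr, hE, mul_zero, zero_mul,
      sub_zero] at h
    have hL := pow_eq_zero_iff two_ne_zero |>.1 (le_antisymm h (sq_nonneg _))
    exact hn.1 (eq_zero_of_integrals_eq_zero hr hΔ hn.2 hE hL hK)
  exists_sinSq := ⟨sinSqTheta x, sinSqTheta_nonneg x, sinSqTheta_le_one x,
    angMom_sub_energy_mul_sinSqTheta M a hr v ▸ azimuthalForm_sq_le_carterK_mul hr hΔ hn.2⟩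

lemma AreNullIntegrals.admissibleIntegrals {E L Q : ℝ} (h : AreNullIntegrals M a E L Q)
    (hM : |a| < M) : AdmissibleIntegrals a E L (Q + (L - a * E) ^ 2) := by
  obtain ⟨x, v, hx, hn, rfl, rfl, rfl⟩ := h
  have hΔr : 0 < rad x ∧ Delta M a (rad x) ≠ 0 := by
    rcases hx with hx | hx
    · exact ⟨(rPlus_pos hM).trans hx, (Delta_pos hM hx).ne'⟩
    · exact ⟨(rMinus_nonneg (pos_of_abs_lt hM).le).trans_lt hx.1, (Delta_neg hM hx.1 hx.2).ne⟩
  rw [carterQ, sub_add_cancel]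
  exact hn.admissibleIntegrals hΔr.1 hΔr.2

end FirstIntegrals

namespace AdmissibleIntegrals

variable {a E L K k r : ℝ}

lemma exists_abs_sub_le (h : AdmissibleIntegrals a E L (k ^ 2)) (hk : 0 ≤ k) :
    ∃ σ, 0 ≤ σ ∧ σ ≤ 1 ∧ |L - a * E * σ| ≤ k := by
  obtain ⟨σ, hσ₀, hσ₁, hσ⟩ := h.exists_sinSq
  exact ⟨σ, hσ₀, hσ₁, abs_le_of_sq_le_sq
    (hσ.trans (mul_le_of_le_one_right (sq_nonneg k) hσ₁)) hk⟩

lemma abs_angMom_le (h : AdmissibleIntegrals a E L (k ^ 2)) (hk : 0 ≤ k) :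
    |L| ≤ k + |a| * |E| := by
  obtain ⟨σ, hσ₀, hσ₁, hσ⟩ := h.exists_abs_sub_le hk
  calc |L| ≤ |L - a * E * σ| + |a * E * σ| := by simpa using abs_add_le (L - a * E * σ) (a * E * σ)
    _ ≤ k + |a * E| * σ := by rw [abs_mul (a * E), abs_of_nonneg hσ₀]; gcongr
    _ ≤ k + |a * E| := by gcongr; exact mul_le_of_le_one_right (abs_nonneg _) hσ₁
    _ = k + |a| * |E| := by rw [abs_mul]

lemma exists_abs_mul_energy_sub_radialP_le (h : AdmissibleIntegrals a E L (k ^ 2)) (hk : 0 ≤ k)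
    (r : ℝ) : ∃ b, 0 ≤ b ∧ b ≤ a ^ 2 ∧ |(r ^ 2 + b) * E - radialP a E L r| ≤ |a| * k := by
  obtain ⟨σ, hσ₀, hσ₁, hσ⟩ := h.exists_abs_sub_le hk
  refine ⟨a ^ 2 * (1 - σ), mul_nonneg (sq_nonneg a) (sub_nonneg.2 hσ₁),
    mul_le_of_le_one_right (sq_nonneg a) (sub_le_self _ hσ₀), ?_⟩
  calc |(r ^ 2 + a ^ 2 * (1 - σ)) * E - radialP a E L r| = |a| * |L - a * E * σ| := by
        rw [radialP, ← abs_mul]; ring_nf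
    _ ≤ |a| * k := by gcongr

lemma sq_mul_abs_energy_le_abs_radialP (h : AdmissibleIntegrals a E L 0) (r : ℝ) :
    r ^ 2 * |E| ≤ |radialP a E L r| := by
  obtain ⟨b, hb, -, hP⟩ := exists_abs_mul_energy_sub_radialP_le (k := 0) (by simpa using h) le_rfl r
  rw [mul_zero, abs_nonpos_iff, sub_eq_zero] at hP
  rw [← hP, abs_mul, abs_of_nonneg (by positivity : 0 ≤ r ^ 2 + b)]
  exact mul_le_mul_of_nonneg_right (le_add_of_nonneg_right hb) (abs_nonneg E)

lemma radialP_ne_zero (h : AdmissibleIntegrals a E L 0) (hr : r ≠ 0) : radialP a E L r ≠ 0 :=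
  abs_pos.1 (lt_of_lt_of_le
    (mul_pos (by positivity) (abs_pos.2 (h.energy_ne_zero rfl)))
    (h.sq_mul_abs_energy_le_abs_radialP r))

end AdmissibleIntegrals

section RadialPotential

variable {M a E L K Q k r : ℝ}

/-- The derivative of `r ↦ radialP a E L r ^ 2 - Delta M a r * K`, that is of the radial potential
expressed through `K` instead of `Q`. -/
def radialSlope (M a E L K r : ℝ) : ℝ := 4 * r * E * radialP a E L r - 2 * (r - M) * K

lemma hasDerivAt_radialPotential (M a E L Q r : ℝ) :
    HasDerivAt (radialPotential M a E L Q) (radialSlope M a E L (Q + (L - a * E) ^ 2) r) r := by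
  have hP : HasDerivAt (radialP a E L) (2 * r * E) r :=
    ((((hasDerivAt_pow 2 r).add_const (a ^ 2)).mul_const E).sub_const (a * L)).congr_deriv
      (by push_cast; ring)
  refine ((hP.fun_pow 2).sub
    ((hasDerivAt_Delta M a r).mul_const (Q + (L - a * E) ^ 2))).congr_deriv ?_
  rw [radialSlope]
  push_cast
  ring

namespace IsDoubleZero

lemma radialP_sq_eq (h : IsDoubleZero M a E L Q r) :
    radialP a E L r ^ 2 = Delta M a r * (Q + (L - a * E) ^ 2) :=
  sub_eq_zero.1 h.1

lemma radialSlope_eq_zero (h : IsDoubleZero M a E L Q r) :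
    radialSlope M a E L (Q + (L - a * E) ^ 2) r = 0 :=
  (hasDerivAt_radialPotential M a E L Q r).deriv ▸ h.2

end IsDoubleZero

lemma sqrt_Delta_le (hM : |a| < M) (hr : M < r) : √(Delta M a r) ≤ r := by
  have hM₀ := pos_of_abs_lt hM
  have ha : a ^ 2 < M ^ 2 := sq_lt_sq.2 (hM.trans_le (le_abs_self M))
  refine Real.sqrt_le_iff.2 ⟨(hM₀.trans hr).le, ?_⟩
  rw [Delta]
  nlinarith

lemma sqrt_Delta_mul_add_lt (hM : |a| < M) (hr : rPlus M a < r) (hr₃ : r < 3 * M - 4 * |a|) :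
    2 * √(Delta M a r) * (√(Delta M a r) + |a|) < r * (r - M) := by
  have hMr := (lt_rPlus hM).trans hr
  have hr₀ := (pos_of_abs_lt hM).trans hMr
  have hq : √(Delta M a r) ^ 2 = r ^ 2 - 2 * M * r + |a| ^ 2 := by
    rw [Real.sq_sqrt (Delta_pos hM hr).le, Delta, sq_abs]
  calc 2 * √(Delta M a r) * (√(Delta M a r) + |a|)
      = 2 * √(Delta M a r) ^ 2 + 2 * √(Delta M a r) * |a| := by ring
    _ ≤ 2 * √(Delta M a r) ^ 2 + 2 * r * |a| := by gcongr; exact sqrt_Delta_le hM hMr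
    _ < r * (r - M) := by
      rw [hq]
      nlinarith [mul_lt_mul_of_pos_left hr₃ hr₀,
        mul_nonneg (abs_nonneg a) (sub_nonneg.2 (hM.trans hMr).le)]

lemma lt_mul_sqrt_Delta_sub (hM : |a| < M) (hr : 3 * M + 2 * |a| < r) :
    (r - M) * (r ^ 2 + a ^ 2) < 2 * r * √(Delta M a r) * (√(Delta M a r) - |a|) := by
  have hM₀ := pos_of_abs_lt hM
  have hMr : M < r := by linarith [abs_nonneg a]
  have hr₀ := hM₀.trans hMr
  have hrp : rPlus M a < r := by linarith [rPlus_le (a := a) hM₀.le, abs_nonneg a]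
  have hq : √(Delta M a r) ^ 2 = r ^ 2 - 2 * M * r + a ^ 2 :=
    Real.sq_sqrt (Delta_pos hM hrp).le
  calc (r - M) * (r ^ 2 + a ^ 2)
      < 2 * r * (r ^ 2 - 2 * M * r + a ^ 2) - 2 * r * r * |a| := by
        nlinarith [mul_lt_mul_of_pos_left hr (pow_pos hr₀ 2),
          mul_nonneg (sq_nonneg a) (add_pos hM₀ hr₀).le]
    _ = 2 * r * √(Delta M a r) ^ 2 - 2 * r * r * |a| := by rw [hq]
    _ ≤ 2 * r * √(Delta M a r) ^ 2 - 2 * r * √(Delta M a r) * |a| := by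
        gcongr
        exact sqrt_Delta_le hM hMr
    _ = 2 * r * √(Delta M a r) * (√(Delta M a r) - |a|) := by ring

end RadialPotential

namespace AdmissibleIntegrals

variable {M a E L K k r : ℝ}

lemma exists_sqrt_carter (h : AdmissibleIntegrals a E L K) (hr : r ≠ 0) (hΔ : 0 < Delta M a r)
    (hR : radialP a E L r ^ 2 = Delta M a r * K) :
    ∃ k, 0 < k ∧ K = k ^ 2 ∧ |radialP a E L r| = √(Delta M a r) * k := by
  have hK : K ≠ 0 := by
    rintro rfl
    refine h.radialP_ne_zero hr (pow_eq_zero_iff two_ne_zero |>.1 ?_)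
    rw [hR, mul_zero]
  refine ⟨√K, Real.sqrt_pos.2 (h.carter_nonneg.lt_of_ne' hK),
    (Real.sq_sqrt h.carter_nonneg).symm, ?_⟩
  rw [← Real.sqrt_sq_eq_abs, hR, Real.sqrt_mul hΔ.le]

lemma exists_abs_energy_mul_radialP_sub_le (h : AdmissibleIntegrals a E L (k ^ 2)) (hk : 0 ≤ k)
    (r : ℝ) : ∃ b, 0 ≤ b ∧ b ≤ a ^ 2 ∧
      |(r ^ 2 + b) * (E * radialP a E L r) - radialP a E L r ^ 2|
        ≤ |a| * k * |radialP a E L r| := by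
  obtain ⟨b, hb₀, hb, hP⟩ := h.exists_abs_mul_energy_sub_radialP_le hk r
  refine ⟨b, hb₀, hb, ?_⟩
  calc |(r ^ 2 + b) * (E * radialP a E L r) - radialP a E L r ^ 2|
      = |(r ^ 2 + b) * E - radialP a E L r| * |radialP a E L r| := by rw [← abs_mul]; ring_nf
    _ ≤ |a| * k * |radialP a E L r| := by gcongr

lemma radialSlope_neg (h : AdmissibleIntegrals a E L K) (hM : |a| < M) (hr : rPlus M a < r)
    (hr₃ : r < 3 * M - 4 * |a|) (hR : radialP a E L r ^ 2 = Delta M a r * K) :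
    radialSlope M a E L K r < 0 := by
  have hMr := (lt_rPlus hM).trans hr
  have hr₀ := (pos_of_abs_lt hM).trans hMr
  obtain ⟨k, hk, rfl, hPk⟩ := h.exists_sqrt_carter hr₀.ne' (Delta_pos hM hr) hR
  obtain ⟨b, hb, -, hEP⟩ := h.exists_abs_energy_mul_radialP_sub_le hk.le r
  have hq := sqrt_Delta_mul_add_lt hM hr hr₃
  rw [← sq_abs (radialP a E L r), hPk] at hEP
  rw [radialSlope]
  set q := √(Delta M a r)
  set y := E * radialP a E L r
  rcases le_or_gt y 0 with hy | hy
  · nlinarith [mul_nonpos_of_nonneg_of_nonpos hr₀.le hy, mul_pos (sub_pos.2 hMr) (pow_pos hk 2)]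
  · have hry : r ^ 2 * y ≤ k ^ 2 * (q * (q + |a|)) := by
      nlinarith [(abs_le.1 hEP).2, mul_nonneg hb hy.le]
    have hlt : r * (2 * r * y) < r * ((r - M) * k ^ 2) := by
      nlinarith [mul_lt_mul_of_pos_left hq (pow_pos hk 2)]
    linarith [lt_of_mul_lt_mul_left hlt hr₀.le]

lemma radialSlope_pos (h : AdmissibleIntegrals a E L K) (hM : |a| < M)
    (hr : 3 * M + 2 * |a| < r) (hR : radialP a E L r ^ 2 = Delta M a r * K) :
    0 < radialSlope M a E L K r := by
  have hM₀ := pos_of_abs_lt hM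
  have hMr : M < r := by linarith [abs_nonneg a]
  have hr₀ := hM₀.trans hMr
  have hrp : rPlus M a < r := by linarith [rPlus_le (a := a) hM₀.le, abs_nonneg a]
  obtain ⟨k, hk, rfl, hPk⟩ := h.exists_sqrt_carter hr₀.ne' (Delta_pos hM hrp) hR
  obtain ⟨b, hb, hba, hEP⟩ := h.exists_abs_energy_mul_radialP_sub_le hk.le r
  have hq := lt_mul_sqrt_Delta_sub hM hr
  have hq₀ := Real.sqrt_pos.2 (Delta_pos hM hrp)
  rw [← sq_abs (radialP a E L r), hPk] at hEP
  rw [radialSlope]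
  set q := √(Delta M a r)
  set y := E * radialP a E L r
  have haq : 0 < q - |a| := by
    refine pos_of_mul_pos_right (lt_trans ?_ hq) (by positivity)
    exact mul_pos (sub_pos.2 hMr) (by positivity)
  have hby : k ^ 2 * (q * (q - |a|)) ≤ (r ^ 2 + b) * y := by linarith [(abs_le.1 hEP).1]
  have hy : 0 < y := pos_of_mul_pos_right (lt_of_lt_of_le (by positivity) hby) (by positivity)
  have hlt : (r ^ 2 + a ^ 2) * ((r - M) * k ^ 2) < (r ^ 2 + a ^ 2) * (2 * r * y) :=
    calc (r ^ 2 + a ^ 2) * ((r - M) * k ^ 2) = k ^ 2 * ((r - M) * (r ^ 2 + a ^ 2)) := by ring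
      _ < k ^ 2 * (2 * r * q * (q - |a|)) := by gcongr
      _ = 2 * r * (k ^ 2 * (q * (q - |a|))) := by ring
      _ ≤ 2 * r * ((r ^ 2 + a ^ 2) * y) := by
        refine mul_le_mul_of_nonneg_left (hby.trans ?_) (by positivity)
        exact mul_le_mul_of_nonneg_right (add_le_add_right hba _) hy.le
      _ = (r ^ 2 + a ^ 2) * (2 * r * y) := by ring
  linarith [lt_of_mul_lt_mul_left hlt (by positivity)]

lemma not_isZero_between (h : AdmissibleIntegrals a E L K) (hM : |a| < M) (h₁ : rMinus M a < r)
    (h₂ : r < rPlus M a) : radialP a E L r ^ 2 ≠ Delta M a r * K := by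
  intro hR
  have hΔ := Delta_neg hM h₁ h₂
  have hP : radialP a E L r ^ 2 = 0 :=
    le_antisymm (hR ▸ mul_nonpos_of_nonpos_of_nonneg hΔ.le h.carter_nonneg) (sq_nonneg _)
  obtain rfl : K = 0 := (mul_eq_zero.1 (hR ▸ hP)).resolve_left hΔ.ne
  exact h.radialP_ne_zero ((rMinus_nonneg (pos_of_abs_lt hM).le).trans_lt h₁).ne'
    (pow_eq_zero_iff two_ne_zero |>.1 hP)

lemma Delta_ne_zero_of_double_zero (h : AdmissibleIntegrals a E L K) (hr : r ≠ 0) (hrM : r ≠ M)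
    (hR : radialP a E L r ^ 2 = Delta M a r * K) (hS : radialSlope M a E L K r = 0) :
    Delta M a r ≠ 0 := by
  intro hΔ
  rw [hΔ, zero_mul, pow_eq_zero_iff two_ne_zero] at hR
  rw [radialSlope, hR, mul_zero, zero_sub, neg_eq_zero] at hS
  obtain rfl : K = 0 := (mul_eq_zero.1 hS).resolve_left (by simpa [sub_eq_zero] using hrM)
  exact h.radialP_ne_zero hr hR

lemma rPlus_lt_of_double_zero (h : AdmissibleIntegrals a E L K) (hM : |a| < M) (hr₀ : r ≠ 0)
    (hr : rMinus M a ≤ r) (hR : radialP a E L r ^ 2 = Delta M a r * K)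
    (hS : radialSlope M a E L K r = 0) : rPlus M a < r := by
  have hΔ (hrM : r ≠ M) := h.Delta_ne_zero_of_double_zero hr₀ hrM hR hS
  rw [Delta_eq_mul hM, mul_ne_zero_iff, sub_ne_zero, sub_ne_zero] at hΔ
  by_contra! hle
  have hlt : r < rPlus M a := hle.lt_of_ne fun h₀ => (hΔ (h₀ ▸ (lt_rPlus hM).ne')).1 h₀
  have hgt : rMinus M a < r := hr.lt_of_ne' fun h₀ => (hΔ (h₀ ▸ (rMinus_lt hM).ne)).2 h₀
  exact h.not_isZero_between hM hgt hlt hR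

lemma mem_Icc_of_double_zero (h : AdmissibleIntegrals a E L K) (hM : |a| < M)
    (hr : rPlus M a < r) (hR : radialP a E L r ^ 2 = Delta M a r * K)
    (hS : radialSlope M a E L K r = 0) : r ∈ Set.Icc (3 * M - 4 * |a|) (3 * M + 2 * |a|) :=
  ⟨not_lt.1 fun hlt => (h.radialSlope_neg hM hr hlt hR).ne hS,
    not_lt.1 fun hgt => (h.radialSlope_pos hM hgt hR).ne' hS⟩

lemma exists_sqrt_le_of_double_zero (h : AdmissibleIntegrals a E L K) (hM : 100 * |a| ≤ M)
    (hM₀ : 0 < M) (hr : rPlus M a < r) (hR : radialP a E L r ^ 2 = Delta M a r * K)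
    (hS : radialSlope M a E L K r = 0) : ∃ k, 0 ≤ k ∧ K = k ^ 2 ∧ k ≤ 11 * M * |E| := by
  have haM : |a| < M := by linarith [abs_nonneg a]
  obtain ⟨hr₁, hr₂⟩ := h.mem_Icc_of_double_zero haM hr hR hS
  have hr₀ := (rPlus_pos haM).trans hr
  obtain ⟨k, hk, rfl, hPk⟩ := h.exists_sqrt_carter hr₀.ne' (Delta_pos haM hr) hR
  refine ⟨k, hk.le, rfl, ?_⟩
  have hq := sqrt_Delta_le haM ((lt_rPlus haM).trans hr)
  have hkE : (r - M) * k ^ 2 ≤ 2 * r * |E| * (r * k) :=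
    calc (r - M) * k ^ 2 = 2 * r * (E * radialP a E L r) := by
          rw [radialSlope] at hS
          linarith
      _ ≤ 2 * r * (|E| * |radialP a E L r|) :=
          mul_le_mul_of_nonneg_left ((le_abs_self _).trans (abs_mul E _).le) (by positivity)
      _ = 2 * r * |E| * (√(Delta M a r) * k) := by rw [hPk]; ring
      _ ≤ 2 * r * |E| * (r * k) := by gcongr
  have hkE' : (r - M) * k ≤ 2 * r ^ 2 * |E| := by
    refine le_of_mul_le_mul_right ?_ hk
    linarith
  have hcoeff : 2 * r ^ 2 ≤ (r - M) * (11 * M) := by nlinarith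
  refine le_of_mul_le_mul_left (a := r - M) ?_ (by linarith)
  calc (r - M) * k ≤ 2 * r ^ 2 * |E| := hkE'
    _ ≤ (r - M) * (11 * M) * |E| := by gcongr
    _ = (r - M) * (11 * M * |E|) := by ring

end AdmissibleIntegrals

section TimelikeRegion

variable {M a ω : ℝ} {x : Pt}

lemma rhoSq_mul_metric_dT_add_smul_dPhi (M a ω : ℝ) (hr : 0 < rad x) :
    rhoSq a x * metric M a x (dT + ω • dPhi x) (dT + ω • dPhi x)
      = sinSqTheta x * ((rad x ^ 2 + a ^ 2) * ω - a) ^ 2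
        - Delta M a (rad x) * (1 - a * ω * sinSqTheta x) ^ 2 := by
  have hρ := (rhoSq_pos a hr).ne'
  have hdT : sinSqDphi x dT = 0 := by simp [sinSqDphi, dT]
  have hdPhi : dPhi x 0 = 0 := by simp [dPhi]
  have hdT₀ : dT 0 = 1 := by simp [dT]
  rw [add_comm, metric_smul_add_left, metric_comm _ _ _ (dPhi x), metric_comm _ _ _ dT,
    metric_smul_add_left, metric_smul_add_left, metric_dPhi M a hr, metric_dPhi M a hr,
    metric_dT, metric_dT, sinSqDphi_dPhi hr, hdT, hdPhi, hdT₀]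
  field_simp
  rw [eq_sub_of_add_eq (rhoSq_add_sq_mul_sinSqTheta a x), Delta]
  ring

lemma isTimelike_vI (hM : 0 < M) (hr : 2 * M < rad x) : IsTimelike M a x vI := by
  have hr₀ : 0 < rad x := by linarith
  have hg := rhoSq_mul_metric_dT_add_smul_dPhi M a 0 hr₀
  rw [zero_smul, add_zero] at hg
  refine neg_of_mul_neg_right (a := rhoSq a x) ?_ (rhoSq_pos a hr₀).le
  rw [vI, hg, Delta]
  nlinarith [mul_le_of_le_one_left (sq_nonneg a) (sinSqTheta_le_one x)]

lemma isTimelike_vH (hM₀ : 0 < M) (hM : 100 * |a| ≤ M) (hr : 29 / 10 * M < rad x)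
    (hr' : rad x < 31 / 10 * M) : IsTimelike M a x (vH M a x) := by
  have hr₀ : 0 < rad x := by linarith
  have haM : |a| < M := by linarith [abs_nonneg a]
  have hp := lt_rPlus haM
  have hp₀ := rPlus_pos haM
  have hs₁ := sinSqTheta_le_one x
  have hg : rhoSq a x * metric M a x (vH M a x) (vH M a x) * (rPlus M a ^ 2 + a ^ 2) ^ 2
      = sinSqTheta x * (a * (rad x ^ 2 - rPlus M a ^ 2)) ^ 2
        - Delta M a (rad x) * (rPlus M a ^ 2 + a ^ 2 * (1 - sinSqTheta x)) ^ 2 := by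
    rw [vH, rhoSq_mul_metric_dT_add_smul_dPhi M a _ hr₀, omegaH]
    field_simp
    ring
  have hrot : sinSqTheta x * (a * (rad x ^ 2 - rPlus M a ^ 2)) ^ 2 ≤ M ^ 6 / 100 := by
    have hp_le := rPlus_le (a := a) hM₀.le
    have hdiff : |a * (rad x ^ 2 - rPlus M a ^ 2)| ≤ M / 100 * (10 * M ^ 2) := by
      rw [abs_mul]
      refine mul_le_mul (by linarith) (abs_le.2 ⟨by nlinarith, by nlinarith⟩) (abs_nonneg _) ?_
      positivity
    calc sinSqTheta x * (a * (rad x ^ 2 - rPlus M a ^ 2)) ^ 2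
        ≤ (a * (rad x ^ 2 - rPlus M a ^ 2)) ^ 2 := mul_le_of_le_one_left (sq_nonneg _) hs₁
      _ ≤ (M / 100 * (10 * M ^ 2)) ^ 2 := by rw [← sq_abs]; gcongr
      _ = M ^ 6 / 100 := by ring
  have hlapse : M ^ 6
      ≤ Delta M a (rad x) * (rPlus M a ^ 2 + a ^ 2 * (1 - sinSqTheta x)) ^ 2 := by
    have hΔ : M ^ 2 ≤ Delta M a (rad x) := by
      rw [Delta]
      nlinarith [mul_pos (sub_pos.2 hr) hM₀, sq_nonneg a]
    have hN' : M ^ 2 ≤ rPlus M a ^ 2 + a ^ 2 * (1 - sinSqTheta x) := by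
      nlinarith [mul_nonneg (sq_nonneg a) (sub_nonneg.2 hs₁)]
    calc M ^ 6 = M ^ 2 * (M ^ 2) ^ 2 := by ring
      _ ≤ _ := mul_le_mul hΔ (pow_le_pow_left₀ (sq_nonneg M) hN' 2) (by positivity)
        ((sq_nonneg M).trans hΔ)
  have hneg : rhoSq a x * metric M a x (vH M a x) (vH M a x) < 0 := by
    refine neg_of_mul_neg_left (b := (rPlus M a ^ 2 + a ^ 2) ^ 2) ?_ (sq_nonneg _)
    rw [hg]
    linarith [pow_pos hM₀ 6]
  exact neg_of_mul_neg_right hneg (rhoSq_pos a hr₀).le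

lemma eventually_isTimelike (hM₀ : 0 < M) (hM : 100 * |a| ≤ M) (hr : 29 / 10 * M < rad x)
    (hr' : rad x < 31 / 10 * M) :
    ∀ᶠ y in 𝓝 x, IsTimelike M a y (vH M a y) ∧ IsTimelike M a y vI := by
  have hrad : Continuous rad := by unfold rad; fun_prop
  filter_upwards [hrad.continuousAt.eventually (Ioo_mem_nhds hr hr')] with y hy
  exact ⟨isTimelike_vH hM₀ hM hy.1 hy.2, isTimelike_vI hM₀ (by linarith [hy.1])⟩

end TimelikeRegion

section DoubleZeros

variable {M a E L Q r : ℝ}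

theorem not_isDoubleZero_between (hM : |a| < M) (h : AreNullIntegrals M a E L Q)
    (h₁ : rMinus M a < r) (h₂ : r < rPlus M a) : ¬ IsDoubleZero M a E L Q r :=
  fun hd => (h.admissibleIntegrals hM).not_isZero_between hM h₁ h₂ hd.radialP_sq_eq

theorem rPlus_lt_and_mem_Icc_of_isDoubleZero (hM : |a| < M) (h : AreNullIntegrals M a E L Q)
    (hr₀ : r ≠ 0) (hr : rMinus M a ≤ r) (hd : IsDoubleZero M a E L Q r) :
    rPlus M a < r ∧ r ∈ Set.Icc (3 * M - 4 * |a|) (3 * M + 2 * |a|) := by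
  have hA := h.admissibleIntegrals hM
  have hrp := hA.rPlus_lt_of_double_zero hM hr₀ hr hd.radialP_sq_eq hd.radialSlope_eq_zero
  exact ⟨hrp, hA.mem_Icc_of_double_zero hM hrp hd.radialP_sq_eq hd.radialSlope_eq_zero⟩

theorem abs_div_energy_le_of_isDoubleZero (hM₀ : 0 < M) (hM : 100 * |a| ≤ M)
    (h : AreNullIntegrals M a E L Q) (hE : E ≠ 0) (hr : rPlus M a < r)
    (hd : IsDoubleZero M a E L Q r) : |L / E| ≤ 12 * M ∧ |Q / E ^ 2| ≤ 169 * M ^ 2 := by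
  have haM : |a| < M := by linarith [abs_nonneg a]
  have hA := h.admissibleIntegrals haM
  obtain ⟨k, hk, hKk, hkE⟩ := hA.exists_sqrt_le_of_double_zero hM hM₀ hr
    hd.radialP_sq_eq hd.radialSlope_eq_zero
  have hL : |L| ≤ 12 * M * |E| :=
    calc |L| ≤ k + |a| * |E| := (hKk ▸ hA).abs_angMom_le hk
      _ ≤ 11 * M * |E| + M * |E| := by gcongr
      _ = 12 * M * |E| := by ring
  have hLaE : |L - a * E| ≤ 13 * M * |E| :=
    calc |L - a * E| ≤ |L| + |a * E| := abs_sub _ _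
      _ = |L| + |a| * |E| := by rw [abs_mul]
      _ ≤ 12 * M * |E| + M * |E| := by gcongr
      _ = 13 * M * |E| := by ring
  have hLaE_sq : (L - a * E) ^ 2 ≤ 169 * M ^ 2 * E ^ 2 := by
    rw [← sq_abs, ← sq_abs E]
    exact (pow_le_pow_left₀ (abs_nonneg _) hLaE 2).trans_eq (by ring)
  have hk_sq : k ^ 2 ≤ 121 * M ^ 2 * E ^ 2 := by
    rw [← sq_abs E]
    exact (pow_le_pow_left₀ hk hkE 2).trans_eq (by ring)
  constructor
  · rwa [abs_div, div_le_iff₀ (abs_pos.2 hE)]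
  · rw [abs_div, abs_of_nonneg (sq_nonneg E), div_le_iff₀ (by positivity)]
    exact abs_le.2 ⟨by nlinarith, by nlinarith⟩

theorem isTimelike_of_isDoubleZero (hM₀ : 0 < M) (hM : 100 * |a| ≤ M)
    (h : AreNullIntegrals M a E L Q) {x : Pt} (hx : rPlus M a ≤ rad x)
    (hd : IsDoubleZero M a E L Q (rad x)) :
    x ∈ exterior M a ∧ IsTimelike M a x (vH M a x) ∧ IsTimelike M a x vI := by
  have haM : |a| < M := by linarith [abs_nonneg a]
  obtain ⟨hr, hr₁, hr₂⟩ := rPlus_lt_and_mem_Icc_of_isDoubleZero haM h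
    ((rPlus_pos haM).trans_le hx).ne' ((rMinus_lt_rPlus haM).le.trans hx) hd
  exact ⟨hr, isTimelike_vH hM₀ hM (by linarith) (by linarith), isTimelike_vI hM₀ (by linarith)⟩

end DoubleZeros

section MatrixSmoothness

variable {E ι : Type*} [NormedAddCommGroup E] [NormedSpace ℝ E] [Fintype ι] [DecidableEq ι]
  {n : WithTop ℕ∞} {A : E → Matrix ι ι ℝ} {x : E}

lemma contDiffAt_det (hA : ∀ i j, ContDiffAt ℝ n (fun y => A y i j) x) :
    ContDiffAt ℝ n (fun y => (A y).det) x := by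
  simp only [Matrix.det_apply]
  exact ContDiffAt.sum fun σ _ => (contDiffAt_prod fun i _ => hA _ _).const_smul _

lemma contDiffAt_matrix_inv (hA : ∀ i j, ContDiffAt ℝ n (fun y => A y i j) x)
    (hdet : (A x).det ≠ 0) (i j : ι) : ContDiffAt ℝ n (fun y => (A y)⁻¹ i j) x := by
  simp only [Matrix.inv_def, Matrix.smul_apply, Ring.inverse_eq_inv', Matrix.adjugate_apply,
    smul_eq_mul]
  refine ((contDiffAt_det hA).inv hdet).mul (contDiffAt_det fun k l => ?_)
  rcases eq_or_ne k j with rfl | hk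
  · simp only [Matrix.updateRow_self]
    exact contDiffAt_const
  · simp only [Matrix.updateRow_ne hk]
    exact hA k l

end MatrixSmoothness

section MetricComponents

variable {M a : ℝ} {x : Pt}

lemma metricComp_comm (M a : ℝ) (i j : Fin 4) : metricComp M a i j = metricComp M a j i :=
  funext fun _ => metric_comm M a _ _ _

lemma metric_eq_sum (M a : ℝ) (x v w : Pt) :
    metric M a x v w = ∑ i, ∑ j, metricComp M a i j x * v i * w j := by
  simp only [Fin.sum_univ_four, metricComp, metric, sphereMetric, sinSqDphi, dr]
  simp
  ring

lemma continuous_rad : Continuous rad := by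
  unfold rad
  fun_prop

lemma isOpen_exterior (M a : ℝ) : IsOpen (exterior M a) :=
  isOpen_lt continuous_const continuous_rad

lemma rad_pos_of_mem (h : |a| < M) (hx : x ∈ exterior M a) : 0 < rad x := (rPlus_pos h).trans hx

lemma contDiffAt_rad (hr : 0 < rad x) : ContDiffAt ℝ 2 rad x := by
  unfold rad
  refine ContDiffAt.sqrt (by fun_prop) ?_
  rw [← rad_sq]
  positivity

lemma contDiffAt_metricComp (h : |a| < M) (hx : x ∈ exterior M a) (i j : Fin 4) :
    ContDiffAt ℝ 2 (metricComp M a i j) x := by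
  have hr := rad_pos_of_mem h hx
  have hr₂ : rad x ^ 2 ≠ 0 := by positivity
  have hΔ₀ : Delta M a (rad x) ≠ 0 := (Delta_pos h hx).ne'
  have hρ₀ := (rhoSq_pos a hr).ne'
  have hrad := contDiffAt_rad hr
  have hdr (v : Pt) : ContDiffAt ℝ 2 (fun x => dr x v) x := by
    unfold dr
    exact ContDiffAt.div (by fun_prop) hrad hr.ne'
  have hφ (v : Pt) : ContDiffAt ℝ 2 (fun x => sinSqDphi x v) x := by
    unfold sinSqDphi
    exact ContDiffAt.div (by fun_prop) (hrad.pow 2) hr₂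
  have hS (v w : Pt) : ContDiffAt ℝ 2 (fun x => sphereMetric x v w) x := by
    unfold sphereMetric
    exact ContDiffAt.div (contDiffAt_const.sub ((hdr v).mul (hdr w))) (hrad.pow 2) hr₂
  have hcos : ContDiffAt ℝ 2 cosTheta x := ContDiffAt.div (by fun_prop) hrad hr.ne'
  have hρ : ContDiffAt ℝ 2 (rhoSq a) x := (hrad.pow 2).add (contDiffAt_const.mul (hcos.pow 2))
  have hΔ : ContDiffAt ℝ 2 (fun x => Delta M a (rad x)) x :=
    ((hrad.pow 2).sub (contDiffAt_const.mul hrad)).add contDiffAt_const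
  have hmass (k : ℝ) : ContDiffAt ℝ 2 (fun x => k * rad x / rhoSq a x) x :=
    (contDiffAt_const.mul hrad).div hρ hρ₀
  unfold metricComp metric
  exact (((((contDiffAt_const.sub (hmass _)).neg.mul contDiffAt_const).sub
    ((hmass _).mul ((contDiffAt_const.mul (hφ _)).add (contDiffAt_const.mul (hφ _))))).add
    ((hρ.div hΔ hΔ₀).mul ((hdr _).mul (hdr _)))).add (hρ.mul (hS _ _))).add
    ((contDiffAt_const.mul (contDiffAt_const.add (hmass _))).mul ((hφ _).mul (hφ _)))

lemma hasDerivAt_metricComp (h : |a| < M) {y : ℝ → Pt} {u : Pt} {s : ℝ}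
    (hx : y s ∈ exterior M a) (hy : HasDerivAt y u s) (i j : Fin 4) :
    HasDerivAt (fun s => metricComp M a i j (y s))
      (∑ k, u k * partialDeriv k (metricComp M a i j) (y s)) s := by
  have hd := ((contDiffAt_metricComp h hx i j).differentiableAt (by norm_num)).hasFDerivAt
  refine (hd.comp_hasDerivAt s hy).congr_deriv ?_
  conv_lhs => rw [pi_eq_sum_univ' u]
  simp [partialDeriv, map_sum]

lemma hasDerivAt_metric (h : |a| < M) {y v w : ℝ → Pt} {y' v' w' : Pt} {s : ℝ}
    (hx : y s ∈ exterior M a) (hy : HasDerivAt y y' s) (hv : HasDerivAt v v' s)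
    (hw : HasDerivAt w w' s) :
    HasDerivAt (fun s => metric M a (y s) (v s) (w s))
      (∑ i, ∑ j, (((∑ k, y' k * partialDeriv k (metricComp M a i j) (y s)) * v s i
        + metricComp M a i j (y s) * v' i) * w s j
        + metricComp M a i j (y s) * v s i * w' j)) s := by
  simp only [metric_eq_sum]
  exact HasDerivAt.fun_sum fun i _ => HasDerivAt.fun_sum fun j _ =>
    ((hasDerivAt_metricComp h hx hy i j).mul (hasDerivAt_pi.1 hv i)).mul (hasDerivAt_pi.1 hw j)

lemma contDiffAt_christoffel (h : |a| < M) (hx : x ∈ exterior M a) (k i j : Fin 4) :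
    ContDiffAt ℝ 1 (christoffel M a k i j) x := by
  have hp (m i j : Fin 4) : ContDiffAt ℝ 1 (partialDeriv m (metricComp M a i j)) x :=
    ((contDiffAt_metricComp h hx i j).fderiv_right (m := 1) (by norm_num)).clm_apply
      contDiffAt_const
  exact (((hp _ _ _).add (hp _ _ _)).sub (hp _ _ _)).div_const 2

lemma eq_zero_of_metric_eq_zero (h : |a| < M) (hx : x ∈ exterior M a) {w : Pt}
    (hw : ∀ u, metric M a x u w = 0) : w = 0 := by
  have hr := rad_pos_of_mem h hx
  have hΔ : Delta M a (rad x) ≠ 0 := (Delta_pos h hx).ne'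
  have hρ := (rhoSq_pos a hr).ne'
  have hE : energy M a x w = 0 := by rw [energy, hw, neg_zero]
  have hL : angMom M a x w = 0 := hw _
  have hτ : carterForm a x w = 0 := by
    have hP := radialP_energy_angMom M a hr w
    rw [hE, hL, radialP, mul_zero, mul_zero, sub_zero] at hP
    exact (mul_eq_zero.1 hP.symm).resolve_left hΔ
  have hα : azimuthalForm a x w = 0 := by
    rw [← angMom_sub_energy_mul_sinSqTheta M a hr, hE, hL]
    ring
  have hφ : sinSqDphi x w = 0 := by
    rw [azimuthalForm_eq, hτ, mul_zero, sub_zero] at hα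
    exact (mul_eq_zero.1 hα).resolve_left hρ
  have ht : w 0 = 0 := by rwa [carterForm, hφ, mul_zero, sub_zero] at hτ
  have hdr : dr x w = 0 := by
    have hR := hw (dR x)
    rw [metric_dR M a hr] at hR
    exact (mul_eq_zero.1 hR).resolve_left (div_ne_zero hρ hΔ)
  refine eq_zero_of_dr_eq_zero_of_sphereMetric_eq_zero hr ht hdr ?_
  have hg := hw w
  rw [metric, ht, hdr, hφ] at hg
  exact (mul_eq_zero.1 (by linarith : rhoSq a x * sphereMetric x w w = 0)).resolve_left hρ

/-- The matrix `(g_{ij})` of the metric. -/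
def metricMatrix (M a : ℝ) (x : Pt) : Matrix (Fin 4) (Fin 4) ℝ :=
  .of fun i j => metricComp M a i j x

lemma metric_eq_dotProduct (M a : ℝ) (x v w : Pt) :
    metric M a x v w = v ⬝ᵥ (metricMatrix M a x).mulVec w := by
  simp only [metric_eq_sum, dotProduct, Matrix.mulVec, metricMatrix, Matrix.of_apply,
    Finset.mul_sum]
  exact Finset.sum_congr rfl fun i _ => Finset.sum_congr rfl fun j _ => by ring

lemma isUnit_det_metricMatrix (h : |a| < M) (hx : x ∈ exterior M a) :
    IsUnit (metricMatrix M a x).det := by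
  refine isUnit_iff_ne_zero.2 fun hdet => ?_
  obtain ⟨w, hw₀, hw⟩ := Matrix.exists_mulVec_eq_zero_iff.2 hdet
  refine hw₀ (eq_zero_of_metric_eq_zero h hx fun u => ?_)
  rw [metric_eq_dotProduct, hw, dotProduct_zero]

end MetricComponents

section GeodesicEquation

variable {M a : ℝ} {γ : ℝ → Pt} {J : Set ℝ}

/-- The covector `Γ_{k,ij} vⁱ vʲ` at the point `z = (x, v)` of the tangent bundle. -/
def christoffelForm (M a : ℝ) (z : Pt × Pt) : Pt :=
  fun k => ∑ i, ∑ j, christoffel M a k i j z.1 * z.2 i * z.2 j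

/-- The geodesic vector field on the tangent bundle, whose integral curves are the pairs
`(γ, γ')` with `γ` a geodesic. -/
def geodesicField (M a : ℝ) (z : Pt × Pt) : Pt × Pt :=
  (z.2, -((metricMatrix M a z.1)⁻¹.mulVec (christoffelForm M a z)))

lemma contDiffOn_geodesicField (h : |a| < M) :
    ContDiffOn ℝ 1 (geodesicField M a) (exterior M a ×ˢ Set.univ) := by
  rintro ⟨x, v⟩ ⟨hx : x ∈ exterior M a, -⟩
  refine ContDiffAt.contDiffWithinAt (contDiffAt_snd.prodMk (contDiffAt_pi.2 fun k => ?_))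
  have hinv (l : Fin 4) :
      ContDiffAt ℝ 1 (fun z : Pt × Pt => (metricMatrix M a z.1)⁻¹ k l) (x, v) :=
    ContDiffAt.comp (x, v) (g := fun x => (metricMatrix M a x)⁻¹ k l)
      (contDiffAt_matrix_inv (fun i j => (contDiffAt_metricComp h hx i j).of_le (by norm_num))
        (isUnit_det_metricMatrix h hx).ne_zero k l) contDiffAt_fst
  have hv (i : Fin 4) : ContDiffAt ℝ 1 (fun z : Pt × Pt => z.2 i) (x, v) := by fun_prop
  have hform (l : Fin 4) : ContDiffAt ℝ 1 (fun z => christoffelForm M a z l) (x, v) :=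
    ContDiffAt.sum fun i _ => ContDiffAt.sum fun j _ =>
      ((ContDiffAt.comp (x, v) (g := christoffel M a l i j) (contDiffAt_christoffel h hx l i j)
        contDiffAt_fst).mul (hv i)).mul (hv j)
  simp only [Pi.neg_apply, Matrix.mulVec, dotProduct]
  exact (ContDiffAt.sum fun l _ => (hinv l).mul (hform l)).neg

lemma eq_geodesicField_snd_iff (h : |a| < M) {z : Pt × Pt} (hz : z.1 ∈ exterior M a) (w : Pt) :
    w = (geodesicField M a z).2
      ↔ ∀ k, ∑ j, metricComp M a k j z.1 * w j + christoffelForm M a z k = 0 := by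
  have hdet := isUnit_det_metricMatrix h hz
  have hform : (∀ k, ∑ j, metricComp M a k j z.1 * w j + christoffelForm M a z k = 0)
      ↔ (metricMatrix M a z.1).mulVec w = -christoffelForm M a z := by
    simp only [funext_iff, eq_neg_iff_add_eq_zero]
    rfl
  rw [hform, geodesicField, ← Matrix.mulVec_neg]
  constructor
  · rintro rfl
    rw [Matrix.mulVec_mulVec, Matrix.mul_nonsing_inv _ hdet, Matrix.one_mulVec]
  · intro hw
    rw [← hw, Matrix.mulVec_mulVec, Matrix.nonsing_inv_mul _ hdet, Matrix.one_mulVec]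

lemma isGeodesicOn_of_hasDerivAt_geodesicField (h : |a| < M) (hJ : IsOpen J) {z : ℝ → Pt × Pt}
    (hz : ∀ s ∈ J, z s ∈ exterior M a ×ˢ (Set.univ : Set Pt) ∧
      HasDerivAt z (geodesicField M a (z s)) s) : IsGeodesicOn M a (fun s => (z s).1) J := by
  have hpos : ∀ s ∈ J, HasDerivAt (fun s => (z s).1) (z s).2 s := fun s hs => (hz s hs).2.fst
  have hvel : ∀ s ∈ J, HasDerivAt (fun s => (z s).2) (geodesicField M a (z s)).2 s :=
    fun s hs => (hz s hs).2.snd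
  have hcont : ContinuousOn (fun s => geodesicField M a (z s)) J :=
    (contDiffOn_geodesicField h).continuousOn.comp
      (fun s hs => (hz s hs).2.continuousAt.continuousWithinAt) fun s hs => (hz s hs).1
  refine ⟨fun s hs => (hz s hs).1.1, contDiffOn_two_of_hasDerivAt hJ hpos hvel hcont.snd,
    fun s hs => ?_⟩
  rw [deriv_deriv_eq_of_hasDerivAt hJ hpos hvel hs, (hpos s hs).deriv]
  exact (eq_geodesicField_snd_iff h (hz s hs).1.1 _).1 rfl

lemma isGeodesicOn_of_locally (hloc : ∀ s ∈ J, ∃ β : ℝ → Pt, ∃ V, IsOpen V ∧ s ∈ V ∧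
    IsGeodesicOn M a β V ∧ Set.EqOn γ β V) : IsGeodesicOn M a γ J := by
  refine ⟨fun s hs => ?_, fun s hs => ?_, fun s hs k => ?_⟩
  all_goals
    obtain ⟨β, V, hV, hsV, hβ, hEq⟩ := hloc s hs
    have hev : γ =ᶠ[𝓝 s] β := hEq.eventuallyEq_of_mem (hV.mem_nhds hsV)
  · rw [hEq hsV]
    exact hβ.1 s hsV
  · exact ((hβ.2.1.contDiffAt (hV.mem_nhds hsV)).congr_of_eventuallyEq hev).contDiffWithinAt
  · rw [hev.deriv_eq, hev.deriv.deriv_eq, hev.eq_of_nhds]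
    exact hβ.2.2 s hsV k

namespace IsGeodesicOn

lemma hasDerivAt (hJ : IsOpen J) (hg : IsGeodesicOn M a γ J) {s : ℝ} (hs : s ∈ J) :
    HasDerivAt γ (deriv γ s) s :=
  ((hg.2.1.contDiffAt (hJ.mem_nhds hs)).differentiableAt (by norm_num)).hasDerivAt

lemma hasDerivAt_deriv (hJ : IsOpen J) (hg : IsGeodesicOn M a γ J) {s : ℝ} (hs : s ∈ J) :
    HasDerivAt (deriv γ) (deriv (deriv γ) s) s :=
  (((hg.2.1.deriv_of_isOpen hJ one_add_one_eq_two.le).contDiffAt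
    (hJ.mem_nhds hs)).differentiableAt (by norm_num)).hasDerivAt

lemma hasDerivAt_prodMk_deriv (h : |a| < M) (hJ : IsOpen J) (hg : IsGeodesicOn M a γ J) {s : ℝ}
    (hs : s ∈ J) :
    HasDerivAt (fun s => (γ s, deriv γ s)) (geodesicField M a (γ s, deriv γ s)) s :=
  ((hg.hasDerivAt hJ hs).prodMk (hg.hasDerivAt_deriv hJ hs)).congr_deriv
    (Prod.ext rfl ((eq_geodesicField_snd_iff h (hg.1 s hs) _).2 (hg.2.2 s hs)))

lemma comp_neg (hg : IsGeodesicOn M a γ J) :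
    IsGeodesicOn M a (fun s => γ (-s)) (Neg.neg ⁻¹' J) := by
  have hderiv : deriv (fun s => γ (-s)) = fun s => -deriv γ (-s) :=
    funext fun s => deriv_comp_neg γ s
  have hderiv₂ : deriv (deriv fun s => γ (-s)) = fun s => deriv (deriv γ) (-s) := by
    rw [hderiv]
    funext s
    rw [deriv.fun_neg, deriv_comp_neg, neg_neg]
  refine ⟨fun s hs => hg.1 _ hs, hg.2.1.comp contDiff_neg.contDiffOn fun s hs => hs,
    fun s hs k => ?_⟩
  rw [hderiv₂, hderiv]
  simpa using hg.2.2 (-s) hs k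

/-- The Euler-Lagrange identity `d/ds g(X, γ') = ½ (𝓛_X g)(γ', γ')` for the affine vector field
`X = b + B x`; the Lie derivative appears as the derivative `D` of the metric along the flow of
`X`, to first order. -/
theorem hasDerivAt_metric_affine (h : |a| < M) (hJ : IsOpen J) (hg : IsGeodesicOn M a γ J) {s : ℝ}
    (hs : s ∈ J) (b : Pt) (B : Pt →L[ℝ] Pt) {D : ℝ}
    (hD : HasDerivAt (fun ε : ℝ => metric M a (γ s + ε • (b + B (γ s)))
      (deriv γ s + ε • B (deriv γ s)) (deriv γ s + ε • B (deriv γ s))) D 0) :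
    HasDerivAt (fun s => metric M a (γ s) (b + B (γ s)) (deriv γ s)) (D / 2) s := by
  have hγ := hg.hasDerivAt hJ hs
  have hX : HasDerivAt (fun s => b + B (γ s)) (B (deriv γ s)) s :=
    (B.hasFDerivAt.comp_hasDerivAt s hγ).const_add b
  have hline (p q : Pt) : HasDerivAt (fun ε : ℝ => p + ε • q) q 0 := by
    simpa using ((hasDerivAt_id (0 : ℝ)).smul_const q).const_add p
  have hflow := hasDerivAt_metric h (y := fun ε : ℝ => γ s + ε • (b + B (γ s))) (s := 0)
    (by simpa using hg.1 s hs) (hline _ _) (hline (deriv γ s) (B (deriv γ s)))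
    (hline (deriv γ s) (B (deriv γ s)))
  refine (hasDerivAt_metric h (hg.1 s hs) hγ hX (hg.hasDerivAt_deriv hJ hs)).congr_deriv ?_
  rw [hD.unique hflow]
  have geo₀ := hg.2.2 s hs 0
  have geo₁ := hg.2.2 s hs 1
  have geo₂ := hg.2.2 s hs 2
  have geo₃ := hg.2.2 s hs 3
  simp only [zero_smul, add_zero, christoffel, Fin.sum_univ_four, metricComp_comm M a 1 0,
    metricComp_comm M a 2 0, metricComp_comm M a 3 0, metricComp_comm M a 2 1,
    metricComp_comm M a 3 1, metricComp_comm M a 3 2] at geo₀ geo₁ geo₂ geo₃ ⊢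
  generalize b + B (γ s) = X at *
  generalize B (deriv γ s) = BV at *
  linear_combination X 0 * geo₀ + X 1 * geo₁ + X 2 * geo₂ + X 3 * geo₃

end IsGeodesicOn

end GeodesicEquation

section MaximalGeodesics

variable {M a : ℝ} {γ : ℝ → Pt} {sm sp : EReal}

lemma isOpen_interval (sm sp : EReal) : IsOpen (interval sm sp) :=
  isOpen_Ioo.preimage continuous_coe_real_ereal

lemma ordConnected_interval (sm sp : EReal) : (interval sm sp).OrdConnected :=
  ⟨fun _ hx _ hy _ hz => ⟨hx.1.trans_le (EReal.coe_le_coe_iff.2 hz.1),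
    (EReal.coe_le_coe_iff.2 hz.2).trans_lt hy.2⟩⟩

lemma nonempty_interval (h : sm < sp) : (interval sm sp).Nonempty :=
  EReal.lt_iff_exists_real_btwn.1 h

lemma neg_preimage_interval (sm sp : EReal) :
    Neg.neg ⁻¹' interval sm sp = interval (-sp) (-sm) := by
  ext s
  simp only [interval, Set.mem_preimage, Set.mem_ofPred_eq, EReal.coe_neg]
  rw [EReal.lt_neg_comm, EReal.neg_lt_comm, and_comm]

theorem IsGeodesicOn.exists_extension (h : |a| < M) {b s₀ : ℝ}
    (hg : IsGeodesicOn M a γ (interval sm b)) (hs₀ : s₀ ∈ interval sm b) {C : Set (Pt × Pt)}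
    (hC : IsCompact C) (hCU : C ⊆ exterior M a ×ˢ Set.univ)
    (hγC : ∀ s ∈ Set.Ioo s₀ b, (γ s, deriv γ s) ∈ C) :
    ∃ c > b, ∃ δ : ℝ → Pt, IsGeodesicOn M a δ (interval sm (c : ℝ)) ∧
      Set.EqOn δ γ (interval sm b) := by
  have hs₀b : s₀ < b := EReal.coe_lt_coe_iff.1 hs₀.2
  have hsub : Set.Ioo s₀ b ⊆ interval sm b := fun s hs =>
    ⟨hs₀.1.trans (EReal.coe_lt_coe_iff.2 hs.1), EReal.coe_lt_coe_iff.2 hs.2⟩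
  obtain ⟨c, hbc, z, hz, hzγ⟩ := exists_solution_extension
    ((isOpen_exterior M a).prod isOpen_univ) (contDiffOn_geodesicField h) hC hCU hs₀b
    (fun s hs => hg.hasDerivAt_prodMk_deriv h (isOpen_interval _ _) (hsub hs)) hγC
  refine ⟨c, hbc, fun s => if s < b then γ s else (z s).1,
    isGeodesicOn_of_locally fun s hs => ?_, fun s hs => if_pos (EReal.coe_lt_coe_iff.1 hs.2)⟩
  rcases lt_or_ge s b with hsb | hbs
  · exact ⟨γ, interval sm b, isOpen_interval _ _, ⟨hs.1, EReal.coe_lt_coe_iff.2 hsb⟩, hg,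
      fun u hu => if_pos (EReal.coe_lt_coe_iff.1 hu.2)⟩
  · refine ⟨_, Set.Ioo s₀ c, isOpen_Ioo, ⟨hs₀b.trans_le hbs, EReal.coe_lt_coe_iff.1 hs.2⟩,
      isGeodesicOn_of_hasDerivAt_geodesicField h isOpen_Ioo hz, fun u hu => ?_⟩
    rcases lt_or_ge u b with hub | hbu
    · simp only [if_pos hub, hzγ ⟨hu.1, hub⟩]
    · exact if_neg hbu.not_gt

/-- `γ`, with parameter interval `]s₋, s₊[`, is a null geodesic which is maximal in the exterior.
Unlike `IsFutureNullGeodesic`, this is invariant under reversal of the parameter. -/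
structure IsMaximalNullGeodesic (M a : ℝ) (γ : ℝ → Pt) (sm sp : EReal) : Prop where
  lt : sm < sp
  geodesic : IsGeodesicOn M a γ (interval sm sp)
  null : ∀ s ∈ interval sm sp, IsNull M a (γ s) (deriv γ s)
  maximal : ∀ (δ : ℝ → Pt) (um up : EReal), um ≤ sm → sp ≤ up →
    IsGeodesicOn M a δ (interval um up) → Set.EqOn δ γ (interval sm sp) → um = sm ∧ up = sp

lemma IsFutureNullGeodesic.isMaximal (h : IsFutureNullGeodesic M a γ sm sp) :
    IsMaximalNullGeodesic M a γ sm sp :=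
  ⟨h.lt, h.geodesic, h.null, h.maximal⟩

namespace IsMaximalNullGeodesic

lemma comp_neg (h : IsMaximalNullGeodesic M a γ sm sp) :
    IsMaximalNullGeodesic M a (fun s => γ (-s)) (-sp) (-sm) where
  lt := EReal.neg_lt_neg_iff.2 h.lt
  geodesic := neg_preimage_interval sm sp ▸ h.geodesic.comp_neg
  null s hs := by
    rw [← neg_preimage_interval] at hs
    rw [deriv_comp_neg]
    exact ⟨neg_ne_zero.2 (h.null _ hs).1, by rw [metric_neg_neg, (h.null _ hs).2]⟩
  maximal δ um up hum hup hδ hEq := by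
    have hmax := h.maximal (fun s => δ (-s)) (-up) (-um) (EReal.neg_le.1 hup) (EReal.le_neg.1 hum)
      (neg_preimage_interval um up ▸ hδ.comp_neg) fun s hs => by
        have hs' : -s ∈ interval (-sp) (-sm) := by rwa [← neg_preimage_interval, Set.mem_preimage,
          neg_neg]
        simpa only [neg_neg] using hEq hs'
    exact ⟨neg_eq_iff_eq_neg.1 hmax.2, neg_eq_iff_eq_neg.1 hmax.1⟩

lemma exists_notMem_of_isCompact (hM : |a| < M) {b s₀ : ℝ}
    (h : IsMaximalNullGeodesic M a γ sm b) (hs₀ : s₀ ∈ interval sm b) {C : Set (Pt × Pt)}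
    (hC : IsCompact C) (hCU : C ⊆ exterior M a ×ˢ Set.univ) :
    ∃ s ∈ Set.Ioo s₀ b, (γ s, deriv γ s) ∉ C := by
  by_contra! hγC
  obtain ⟨c, hbc, δ, hδ, hEq⟩ := h.geodesic.exists_extension hM hs₀ hC hCU hγC
  exact hbc.ne' (EReal.coe_eq_coe_iff.1
    (h.maximal δ sm c le_rfl (EReal.coe_le_coe_iff.2 hbc.le) hδ hEq).2)

end IsMaximalNullGeodesic

end MaximalGeodesics

section Symmetries

variable {M a : ℝ} {x v : Pt}

lemma metric_add_smul_dT (M a ε : ℝ) (x v w : Pt) :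
    metric M a (x + ε • dT) v w = metric M a x v w := by
  simp [metric, rhoSq, cosTheta, sphereMetric, sinSqDphi, dr, rad, dT]

/-- The rotation field `∂_φ` as a linear map. -/
def rotationMap : Pt →L[ℝ] Pt :=
  .pi ![0, -.proj 2, .proj 1, 0]

lemma rotationMap_apply (x : Pt) : rotationMap x = dPhi x := by
  funext i
  fin_cases i <;> rfl

lemma metric_add_neg_smul_dPhi (M a ε : ℝ) (x v : Pt) :
    metric M a (x + (-ε) • dPhi x) (v + (-ε) • dPhi v) (v + (-ε) • dPhi v)
      = metric M a (x + ε • dPhi x) (v + ε • dPhi v) (v + ε • dPhi v) := by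
  have hz (δ : ℝ) (y : Pt) : (y + δ • dPhi y) 0 = y 0 ∧ (y + δ • dPhi y) 1 = y 1 - δ * y 2 ∧
      (y + δ • dPhi y) 2 = y 2 + δ * y 1 ∧ (y + δ • dPhi y) 3 = y 3 := by
    simp [dPhi, sub_eq_add_neg]
  have hrad : rad (x + (-ε) • dPhi x) = rad (x + ε • dPhi x) := by
    simp only [rad, hz]
    congr 1
    ring
  have hcos : cosTheta (x + (-ε) • dPhi x) = cosTheta (x + ε • dPhi x) := by
    simp only [cosTheta, hrad, hz]
  have hdr : dr (x + (-ε) • dPhi x) (v + (-ε) • dPhi v) = dr (x + ε • dPhi x) (v + ε • dPhi v) := by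
    simp only [dr, hrad, hz]
    ring
  have hφ : sinSqDphi (x + (-ε) • dPhi x) (v + (-ε) • dPhi v)
      = sinSqDphi (x + ε • dPhi x) (v + ε • dPhi v) := by
    simp only [sinSqDphi, hrad, hz]
    ring
  simp only [metric, rhoSq, sphereMetric, hrad, hcos, hdr, hφ, hz]
  ring

/-- The spatial dilation by the factor `c`. -/
def dilate (c : ℝ) (x : Pt) : Pt := ![x 0, c * x 1, c * x 2, c * x 3]

/-- The generator `r ∂_r` of the spatial dilations as a linear map. -/
def dilationMap : Pt →L[ℝ] Pt :=
  .pi ![0, .proj 1, .proj 2, .proj 3]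

lemma add_smul_dilationMap (ε : ℝ) (x : Pt) : x + ε • dilationMap x = dilate (1 + ε) x := by
  funext i
  fin_cases i <;> simp [dilationMap, dilate] <;> ring

lemma dilationMap_eq_smul_dR (hr : 0 < rad x) : dilationMap x = rad x • dR x := by
  funext i
  fin_cases i <;> simp [dilationMap, dR] <;> field_simp

lemma metric_dilationMap (M a : ℝ) (hr : 0 < rad x) (v : Pt) :
    metric M a x (dilationMap x) v = rhoSq a x / Delta M a (rad x) * (rad x * dr x v) := by
  have hzero : metric M a x 0 v = 0 := by simp [metric, sphereMetric, sinSqDphi, dr]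
  rw [dilationMap_eq_smul_dR hr, ← add_zero (rad x • dR x), metric_smul_add_left, hzero,
    metric_dR M a hr]
  ring

lemma rad_dilate {c : ℝ} (hc : 0 ≤ c) (x : Pt) : rad (dilate c x) = c * rad x := by
  have h : (c * x 1) ^ 2 + (c * x 2) ^ 2 + (c * x 3) ^ 2
      = c ^ 2 * (x 1 ^ 2 + x 2 ^ 2 + x 3 ^ 2) := by ring
  simp only [rad, dilate, Matrix.cons_val, h]
  rw [Real.sqrt_mul (sq_nonneg c), Real.sqrt_sq hc]

lemma cosTheta_dilate {c : ℝ} (hc : 0 < c) (x : Pt) : cosTheta (dilate c x) = cosTheta x := by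
  simp only [cosTheta, rad_dilate hc.le]
  simp only [dilate, Matrix.cons_val]
  field_simp

lemma dr_dilate {c : ℝ} (hc : 0 < c) (x v : Pt) : dr (dilate c x) (dilate c v) = c * dr x v := by
  simp only [dr, rad_dilate hc.le]
  simp only [dilate, Matrix.cons_val]
  field_simp

lemma sinSqDphi_dilate {c : ℝ} (hc : 0 < c) (x v : Pt) :
    sinSqDphi (dilate c x) (dilate c v) = sinSqDphi x v := by
  simp only [sinSqDphi, rad_dilate hc.le]
  simp only [dilate, Matrix.cons_val]
  field_simp

lemma sphereMetric_dilate {c : ℝ} (hc : 0 < c) (x v : Pt) :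
    sphereMetric (dilate c x) (dilate c v) (dilate c v) = sphereMetric x v v := by
  simp only [sphereMetric, dr_dilate hc, rad_dilate hc.le]
  simp only [dilate, Matrix.cons_val]
  field_simp

lemma metric_self_eq (M a : ℝ) (x v : Pt) :
    metric M a x v v = carterForm a x v ^ 2 - 2 * v 0 * carterForm a x v
      + 2 * M * rad x / rhoSq a x * carterForm a x v ^ 2
      + rhoSq a x / Delta M a (rad x) * dr x v ^ 2 + rhoSq a x * sphereMetric x v v := by
  rw [metric, carterForm]
  ring

lemma metric_dilate (M a : ℝ) {c : ℝ} (hc : 0 < c) (x v : Pt) :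
    metric M a (dilate c x) (dilate c v) (dilate c v)
      = carterForm a x v ^ 2 - 2 * v 0 * carterForm a x v
        + 2 * M * (c * rad x) / ((c * rad x) ^ 2 + a ^ 2 * cosTheta x ^ 2) * carterForm a x v ^ 2
        + ((c * rad x) ^ 2 + a ^ 2 * cosTheta x ^ 2) / Delta M a (c * rad x) * (c * dr x v) ^ 2
        + ((c * rad x) ^ 2 + a ^ 2 * cosTheta x ^ 2) * sphereMetric x v v := by
  have ht : dilate c v 0 = v 0 := rfl
  rw [metric_self_eq, carterForm, sinSqDphi_dilate hc, sphereMetric_dilate hc, dr_dilate hc, rhoSq,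
    cosTheta_dilate hc, rad_dilate hc.le, ht, ← carterForm]

lemma hasDerivAt_metric_dilate (hr : 0 < rad x) (hΔ : Delta M a (rad x) ≠ 0) (v : Pt) :
    HasDerivAt (fun c => metric M a (dilate c x) (dilate c v) (dilate c v))
      (2 * M * rad x * (rhoSq a x - 2 * rad x ^ 2) / rhoSq a x ^ 2 * carterForm a x v ^ 2
        + (2 * rad x ^ 2 / Delta M a (rad x)
          - rhoSq a x * (2 * (rad x - M) * rad x) / Delta M a (rad x) ^ 2
          + 2 * rhoSq a x / Delta M a (rad x)) * dr x v ^ 2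
        + 2 * rad x ^ 2 * sphereMetric x v v) 1 := by
  have hρ := (rhoSq_pos a hr).ne'
  have hr₁ : (1 : ℝ) * rad x = rad x := one_mul _
  have hρ₁ : (1 * rad x) ^ 2 + a ^ 2 * cosTheta x ^ 2 = rhoSq a x := by rw [hr₁, rhoSq]
  have hrad : HasDerivAt (fun c => c * rad x) (rad x) 1 := hasDerivAt_mul_const _
  have hrho : HasDerivAt (fun c => (c * rad x) ^ 2 + a ^ 2 * cosTheta x ^ 2) (2 * rad x ^ 2) 1 :=
    ((hrad.fun_pow 2).add_const _).congr_deriv (by push_cast; ring)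
  have hDelta : HasDerivAt (fun c => Delta M a (c * rad x)) (2 * (rad x - M) * rad x) 1 := by
    simpa only [hr₁, Function.comp_def] using (hasDerivAt_Delta M a (1 * rad x)).comp (1 : ℝ) hrad
  have hdr : HasDerivAt (fun c => c * dr x v) (dr x v) 1 := hasDerivAt_mul_const _
  have hsum := ((((hrad.const_mul (2 * M)).fun_div hrho (by rwa [hρ₁])).mul_const
    (carterForm a x v ^ 2)).const_add (carterForm a x v ^ 2 - 2 * v 0 * carterForm a x v)
    |>.fun_add ((hrho.fun_div hDelta (by rwa [hr₁])).fun_mul (hdr.fun_pow 2))).fun_add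
    (hrho.mul_const (sphereMetric x v v))
  refine (hsum.congr_of_eventuallyEq ?_).congr_deriv ?_
  · filter_upwards [Ioi_mem_nhds one_pos] with c hc using metric_dilate M a hc x v
  · rw [hρ₁, hr₁]
    push_cast
    field_simp

end Symmetries

section Conservation

variable {M a : ℝ} {γ : ℝ → Pt} {J : Set ℝ} {s : ℝ}

lemma hasDerivAt_rad {v : Pt} (hγ : HasDerivAt γ v s) (hr : 0 < rad (γ s)) :
    HasDerivAt (fun s => rad (γ s)) (dr (γ s) v) s := by
  have hcoord (i : Fin 4) : HasDerivAt (fun s => γ s i) (v i) s := hasDerivAt_pi.1 hγ i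
  have hpos : γ s 1 ^ 2 + γ s 2 ^ 2 + γ s 3 ^ 2 ≠ 0 := by rw [← rad_sq]; positivity
  refine ((((hcoord 1).fun_pow 2).fun_add ((hcoord 2).fun_pow 2)).fun_add
    ((hcoord 3).fun_pow 2)).sqrt hpos |>.congr_deriv ?_
  rw [← rad, dr]
  field_simp
  push_cast
  ring

/-- The `r`-component of the geodesic equation, after `E`, `P`, `K` and the angular velocity have
been expressed through `τ = t' - a sin² θ φ'`, `t'` and `r' = p`. -/
lemma radial_equation_identity {M r ρ Δ t τ p S E P K : ℝ} (hr : r ≠ 0) (hρ : ρ ≠ 0) (hΔ : Δ ≠ 0)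
    (hE : E = t - 2 * M * r / ρ * τ) (hP : P = Δ * τ) (hK : Δ * K = P ^ 2 - (ρ * p) ^ 2)
    (hn : τ ^ 2 - 2 * t * τ + 2 * M * r / ρ * τ ^ 2 + ρ / Δ * p ^ 2 + ρ * S = 0) :
    (2 * M * r * (ρ - 2 * r ^ 2) / ρ ^ 2 * τ ^ 2
        + (2 * r ^ 2 / Δ - ρ * (2 * (r - M) * r) / Δ ^ 2 + 2 * ρ / Δ) * p ^ 2
        + 2 * r ^ 2 * S) / 2 * (Δ / r)
      + ρ / Δ * (r * p) * ((2 * (r - M) * p * r - Δ * p) / r ^ 2)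
      = (4 * r * E * P - 2 * (r - M) * K) / (2 * ρ) := by
  obtain rfl : K = (P ^ 2 - (ρ * p) ^ 2) / Δ := by rw [← hK]; field_simp
  obtain rfl : S = (2 * t * τ - τ ^ 2 - 2 * M * r / ρ * τ ^ 2 - ρ / Δ * p ^ 2) / ρ := by
    rw [eq_div_iff hρ]
    linear_combination hn
  rw [hP, hE]
  field_simp
  ring

namespace IsGeodesicOn

lemma hasDerivAt_rad (h : |a| < M) (hJ : IsOpen J) (hg : IsGeodesicOn M a γ J) (hs : s ∈ J) :
    HasDerivAt (fun s => rad (γ s)) (dr (γ s) (deriv γ s)) s :=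
  Kerr.hasDerivAt_rad (hg.hasDerivAt hJ hs) (rad_pos_of_mem h (hg.1 s hs))

lemma hasDerivAt_Delta_rad (h : |a| < M) (hJ : IsOpen J) (hg : IsGeodesicOn M a γ J)
    (hs : s ∈ J) : HasDerivAt (fun s => Delta M a (rad (γ s)))
      (2 * (rad (γ s) - M) * dr (γ s) (deriv γ s)) s :=
  (hasDerivAt_Delta M a _).comp s (hg.hasDerivAt_rad h hJ hs)

lemma hasDerivAt_energy (h : |a| < M) (hJ : IsOpen J) (hg : IsGeodesicOn M a γ J) (hs : s ∈ J) :
    HasDerivAt (fun s => energy M a (γ s) (deriv γ s)) 0 s := by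
  have hT := hg.hasDerivAt_metric_affine h hJ hs dT 0 (D := 0) (by
    simp only [_root_.zero_apply, add_zero, smul_zero, metric_add_smul_dT]
    exact hasDerivAt_const _ _)
  simp only [_root_.zero_apply, add_zero, zero_div] at hT
  exact hT.fun_neg.congr_deriv neg_zero

lemma hasDerivAt_angMom (h : |a| < M) (hJ : IsOpen J) (hg : IsGeodesicOn M a γ J) (hs : s ∈ J) :
    HasDerivAt (fun s => angMom M a (γ s) (deriv γ s)) 0 s := by
  -- `x + ε ∂_φ` is a rotation only up to `O(ε²)`, but the metric along it is an even function.
  let f (ε : ℝ) : ℝ := metric M a (γ s + ε • dPhi (γ s)) (deriv γ s + ε • dPhi (deriv γ s))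
    (deriv γ s + ε • dPhi (deriv γ s))
  have hline (p q : Pt) : HasDerivAt (fun ε : ℝ => p + ε • q) q 0 := by
    simpa using ((hasDerivAt_id (0 : ℝ)).smul_const q).const_add p
  have hdiff : DifferentiableAt ℝ f 0 := (hasDerivAt_metric h (by simpa using hg.1 s hs)
    (hline (γ s) _) (hline _ _) (hline _ _)).differentiableAt
  have heven : (fun ε => f (-ε)) = f :=
    funext fun ε => metric_add_neg_smul_dPhi M a ε (γ s) (deriv γ s)
  have hzero : deriv f 0 = 0 := by
    have hneg := deriv_comp_neg f 0
    rw [heven, neg_zero] at hneg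
    linarith
  have hΦ := hg.hasDerivAt_metric_affine h hJ hs 0 rotationMap (D := 0) (by
    simp only [zero_add, rotationMap_apply]
    exact hdiff.hasDerivAt.congr_deriv hzero)
  simp only [zero_add, rotationMap_apply, zero_div] at hΦ
  exact hΦ

theorem hasDerivAt_radialMomentum (h : |a| < M) (hJ : IsOpen J) (hg : IsGeodesicOn M a γ J)
    (hs : s ∈ J) (hn : metric M a (γ s) (deriv γ s) (deriv γ s) = 0) :
    HasDerivAt (fun s => radialMomentum a (γ s) (deriv γ s))
      (radialSlope M a (energy M a (γ s) (deriv γ s)) (angMom M a (γ s) (deriv γ s))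
        (carterK M a (γ s) (deriv γ s)) (rad (γ s)) / (2 * rhoSq a (γ s))) s := by
  have hr {u : ℝ} (hu : u ∈ J) := rad_pos_of_mem h (hg.1 u hu)
  have hΔ {u : ℝ} (hu : u ∈ J) := (Delta_pos h (hg.1 u hu)).ne'
  have hflow := hg.hasDerivAt_metric_affine h hJ hs 0 dilationMap (by
    simp only [zero_add, add_smul_dilationMap]
    exact HasDerivAt.comp_const_add 1 0
      ((add_zero (1 : ℝ)).symm ▸ hasDerivAt_metric_dilate (hr hs) (hΔ hs) (deriv γ s)))
  simp only [zero_add] at hflow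
  have hquot := (hg.hasDerivAt_Delta_rad h hJ hs).fun_div (hg.hasDerivAt_rad h hJ hs) (hr hs).ne'
  have hW : (fun s => radialMomentum a (γ s) (deriv γ s)) =ᶠ[𝓝 s] fun s =>
      metric M a (γ s) (dilationMap (γ s)) (deriv γ s) * (Delta M a (rad (γ s)) / rad (γ s)) := by
    filter_upwards [hJ.mem_nhds hs] with u hu
    rw [metric_dilationMap M a (hr hu), radialMomentum]
    field_simp [(hr hu).ne', hΔ hu]
  refine ((hflow.fun_mul hquot).congr_of_eventuallyEq hW).congr_deriv ?_
  rw [metric_dilationMap M a (hr hs), radialSlope]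
  refine radial_equation_identity (hr hs).ne' (rhoSq_pos a (hr hs)).ne' (hΔ hs) ?_
    (radialP_energy_angMom M a (hr hs) _) (Delta_mul_carterK (hr hs) (hΔ hs) hn)
    (metric_self_eq M a _ _ ▸ hn)
  rw [energy, metric_dT, carterForm]
  ring

lemma hasDerivAt_carterK (h : |a| < M) (hJ : IsOpen J) (hg : IsGeodesicOn M a γ J) (hs : s ∈ J)
    (hn : ∀ u ∈ J, metric M a (γ u) (deriv γ u) (deriv γ u) = 0) :
    HasDerivAt (fun s => carterK M a (γ s) (deriv γ s)) 0 s := by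
  have hr {u : ℝ} (hu : u ∈ J) := rad_pos_of_mem h (hg.1 u hu)
  have hΔ {u : ℝ} (hu : u ∈ J) := (Delta_pos h (hg.1 u hu)).ne'
  have hρ := (rhoSq_pos a (hr hs)).ne'
  have hP : HasDerivAt (fun u => radialP a (energy M a (γ u) (deriv γ u))
      (angMom M a (γ u) (deriv γ u)) (rad (γ u)))
      (2 * rad (γ s) * dr (γ s) (deriv γ s) * energy M a (γ s) (deriv γ s)) s :=
    (((((hg.hasDerivAt_rad h hJ hs).fun_pow 2).add_const (a ^ 2)).fun_mul
      (hg.hasDerivAt_energy h hJ hs)).fun_sub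
      ((hg.hasDerivAt_angMom h hJ hs).const_mul a)).congr_deriv (by push_cast; ring)
  have hK : (fun s => carterK M a (γ s) (deriv γ s)) =ᶠ[𝓝 s] fun u =>
      (radialP a (energy M a (γ u) (deriv γ u)) (angMom M a (γ u) (deriv γ u)) (rad (γ u)) ^ 2
        - radialMomentum a (γ u) (deriv γ u) ^ 2) / Delta M a (rad (γ u)) := by
    filter_upwards [hJ.mem_nhds hs] with u hu
    rw [eq_div_iff (hΔ hu), mul_comm, Delta_mul_carterK (hr hu) (hΔ hu) (hn u hu)]
  refine (((hP.fun_pow 2).fun_sub ((hg.hasDerivAt_radialMomentum h hJ hs (hn s hs)).fun_pow 2)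
    |>.fun_div (hg.hasDerivAt_Delta_rad h hJ hs) (hΔ hs)).congr_of_eventuallyEq hK).congr_deriv ?_
  rw [← Delta_mul_carterK (hr hs) (hΔ hs) (hn s hs), radialMomentum, radialSlope]
  field_simp
  push_cast
  ring

end IsGeodesicOn

/-- The energy, the angular momentum and the Carter constant of `γ` have on `J` the constant values
`E`, `L` and `K`. -/
structure HasIntegrals (M a : ℝ) (γ : ℝ → Pt) (J : Set ℝ) (E L K : ℝ) : Prop where
  energy_eq : ∀ s ∈ J, energy M a (γ s) (deriv γ s) = E
  angMom_eq : ∀ s ∈ J, angMom M a (γ s) (deriv γ s) = L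
  carterK_eq : ∀ s ∈ J, carterK M a (γ s) (deriv γ s) = K

theorem IsGeodesicOn.exists_hasIntegrals (h : |a| < M) (hJ : IsOpen J) (hJ' : J.OrdConnected)
    (hne : J.Nonempty) (hg : IsGeodesicOn M a γ J)
    (hn : ∀ s ∈ J, IsNull M a (γ s) (deriv γ s)) :
    ∃ E L K, AdmissibleIntegrals a E L K ∧ HasIntegrals M a γ J E L K := by
  obtain ⟨s₀, hs₀⟩ := hne
  have hconst {f : ℝ → ℝ} (hf : ∀ s ∈ J, HasDerivAt f 0 s) (s : ℝ) (hs : s ∈ J) : f s = f s₀ :=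
    hJ.is_const_of_deriv_eq_zero hJ'.isPreconnected
      (fun u hu => (hf u hu).differentiableAt.differentiableWithinAt)
      (fun u hu => (hf u hu).deriv) hs hs₀
  exact ⟨_, _, _, (hn s₀ hs₀).admissibleIntegrals (rad_pos_of_mem h (hg.1 s₀ hs₀))
    (Delta_pos h (hg.1 s₀ hs₀)).ne',
    hconst fun s hs => hg.hasDerivAt_energy h hJ hs,
    hconst fun s hs => hg.hasDerivAt_angMom h hJ hs,
    hconst fun s hs => hg.hasDerivAt_carterK h hJ hs fun u hu => (hn u hu).2⟩

end Conservation

section NullVector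

variable {M a : ℝ} {x v : Pt}

lemma Delta_le_sq {r : ℝ} (hM : |a| ≤ M) (hr : |a| ≤ r) : Delta M a r ≤ r ^ 2 := by
  have hsq : |a| * |a| ≤ M * r :=
    mul_le_mul hM hr (abs_nonneg a) ((abs_nonneg a).trans hM)
  rw [abs_mul_abs_self] at hsq
  rw [Delta]
  nlinarith [sq_nonneg a]

lemma Delta_le_sub_rPlus_mul {r : ℝ} (hM : |a| < M) (hr : rPlus M a ≤ r) :
    Delta M a r ≤ (r - rPlus M a) * r := by
  rw [Delta_eq_mul hM]
  exact mul_le_mul_of_nonneg_left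
    (sub_le_self r (rMinus_nonneg (pos_of_abs_lt hM).le)) (sub_nonneg.2 hr)

lemma abs_lt_rad (hM : |a| < M) (hx : x ∈ exterior M a) : |a| < rad x :=
  hM.trans ((lt_rPlus hM).trans hx)

lemma sq_le_rad_sq (hM : |a| < M) (hx : x ∈ exterior M a) : a ^ 2 ≤ rad x ^ 2 :=
  sq_le_sq' (neg_le_of_abs_le (abs_lt_rad hM hx).le) (le_of_abs_le (abs_lt_rad hM hx).le)

lemma rhoSq_sq_mul_sphereMetric (a : ℝ) (x v : Pt) :
    rhoSq a x ^ 2 * sphereMetric x v v = angularForm a x v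
      + 2 * a * azimuthalForm a x v * carterForm a x v
      + a ^ 2 * sinSqTheta x * carterForm a x v ^ 2 := by
  rw [angularForm, azimuthalForm_eq]
  ring

lemma carterK_le (hM : |a| < M) (hx : x ∈ exterior M a) (hn : metric M a x v v = 0) :
    carterK M a x v ≤ Delta M a (rad x) * carterForm a x v ^ 2 := by
  have hΔ := Delta_pos hM hx
  have hK := Delta_mul_carterK (rad_pos_of_mem hM hx) hΔ.ne' hn
  rw [radialP_energy_angMom M a (rad_pos_of_mem hM hx)] at hK
  refine le_of_mul_le_mul_left ?_ hΔ
  linarith [sq_nonneg (radialMomentum a x v)]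

lemma abs_radialMomentum_le (hM : |a| < M) (hx : x ∈ exterior M a) (hn : metric M a x v v = 0) :
    |radialMomentum a x v| ≤ Delta M a (rad x) * |carterForm a x v| := by
  have hr := rad_pos_of_mem hM hx
  have hΔ := Delta_pos hM hx
  have hK := Delta_mul_carterK hr hΔ.ne' hn
  rw [← abs_of_pos hΔ, ← abs_mul, ← radialP_energy_angMom M a hr]
  exact sq_le_sq.1 (by linarith [mul_nonneg hΔ.le (carterK_nonneg hr hΔ.ne' hn)])

lemma abs_mul_azimuthalForm_le (hM : |a| < M) (hx : x ∈ exterior M a)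
    (hn : metric M a x v v = 0) :
    |a * azimuthalForm a x v| ≤ (rad x ^ 2 + a ^ 2) / 2 * |carterForm a x v| := by
  have hr := rad_pos_of_mem hM hx
  have hΔ := Delta_pos hM hx
  have hΔr := Delta_le_sq hM.le (abs_lt_rad hM hx).le
  have hα : azimuthalForm a x v ^ 2 ≤ Delta M a (rad x) * carterForm a x v ^ 2 :=
    (azimuthalForm_sq_le_carterK_mul hr hΔ.ne' hn).trans <|
      (mul_le_of_le_one_right (carterK_nonneg hr hΔ.ne' hn) (sinSqTheta_le_one x)).trans
        (carterK_le hM hx hn)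
  refine abs_le_of_sq_le_sq ?_ (by positivity)
  calc (a * azimuthalForm a x v) ^ 2 = a ^ 2 * azimuthalForm a x v ^ 2 := by ring
    _ ≤ a ^ 2 * (rad x ^ 2 * carterForm a x v ^ 2) := by
      gcongr
      exact hα.trans (mul_le_mul_of_nonneg_right hΔr (sq_nonneg _))
    _ = a ^ 2 * rad x ^ 2 * carterForm a x v ^ 2 := by ring
    _ ≤ ((rad x ^ 2 + a ^ 2) / 2) ^ 2 * carterForm a x v ^ 2 := by
      gcongr
      linarith [sq_nonneg (rad x ^ 2 - a ^ 2)]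
    _ = ((rad x ^ 2 + a ^ 2) / 2 * |carterForm a x v|) ^ 2 := by rw [mul_pow _ |_|, sq_abs]

lemma abs_carterForm_le (hM : |a| < M) (hx : x ∈ exterior M a) (hn : metric M a x v v = 0) :
    |carterForm a x v| ≤ 2 * |v 0| := by
  have hr := rad_pos_of_mem hM hx
  have hα := abs_mul_azimuthalForm_le hM hx hn
  have hpos : 0 < rad x ^ 2 + a ^ 2 := by positivity
  have hτ : (rad x ^ 2 + a ^ 2) * |carterForm a x v|
      ≤ (rad x ^ 2 + a ^ 2) * |v 0| + (rad x ^ 2 + a ^ 2) / 2 * |carterForm a x v| :=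
    calc (rad x ^ 2 + a ^ 2) * |carterForm a x v|
        = |rhoSq a x * v 0 - a * azimuthalForm a x v| := by
          rw [rhoSq_mul_time, add_sub_cancel_right, abs_mul, abs_of_pos hpos]
      _ ≤ rhoSq a x * |v 0| + |a * azimuthalForm a x v| :=
        (abs_sub _ _).trans_eq (by rw [abs_mul, abs_of_pos (rhoSq_pos a hr)])
      _ ≤ _ := by
        gcongr
        exact rhoSq_le a x
  exact le_of_mul_le_mul_left (by linarith) hpos

lemma abs_dr_le (hM : |a| < M) (hx : x ∈ exterior M a) (hn : metric M a x v v = 0) :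
    |dr x v| ≤ 2 / M * (rad x - rPlus M a) * |v 0| := by
  have hr := rad_pos_of_mem hM hx
  have hM₀ := pos_of_abs_lt hM
  have hrM : M < rad x := (lt_rPlus hM).trans hx
  have hsub : 0 < rad x - rPlus M a := sub_pos.2 hx
  have hmul : rad x * (rad x * |dr x v|) ≤ rad x * (2 * (rad x - rPlus M a) * |v 0|) :=
    calc rad x * (rad x * |dr x v|) = rad x ^ 2 * |dr x v| := by ring
      _ ≤ |radialMomentum a x v| := by
        rw [radialMomentum, abs_mul, abs_of_pos (rhoSq_pos a hr)]
        exact mul_le_mul_of_nonneg_right (rad_sq_le_rhoSq a x) (abs_nonneg _)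
      _ ≤ Delta M a (rad x) * |carterForm a x v| := abs_radialMomentum_le hM hx hn
      _ ≤ (rad x - rPlus M a) * rad x * (2 * |v 0|) := by
        gcongr
        · exact Delta_le_sub_rPlus_mul hM hx.le
        · exact abs_carterForm_le hM hx hn
      _ = rad x * (2 * (rad x - rPlus M a) * |v 0|) := by ring
  rw [div_mul_eq_mul_div, div_mul_eq_mul_div, le_div_iff₀ hM₀, mul_comm]
  exact (mul_le_mul_of_nonneg_right hrM.le (abs_nonneg _)).trans (le_of_mul_le_mul_left hmul hr)

lemma abs_time_le (hM : |a| < M) (hx : x ∈ exterior M a) (hn : metric M a x v v = 0) :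
    |v 0| ≤ 3 * |carterForm a x v| := by
  have hr := rad_pos_of_mem hM hx
  have hα := abs_mul_azimuthalForm_le hM hx hn
  have har := sq_le_rad_sq hM hx
  refine le_of_mul_le_mul_left ?_ (pow_pos hr 2)
  calc rad x ^ 2 * |v 0| ≤ rhoSq a x * |v 0| :=
        mul_le_mul_of_nonneg_right (rad_sq_le_rhoSq a x) (abs_nonneg _)
    _ = |(rad x ^ 2 + a ^ 2) * carterForm a x v + a * azimuthalForm a x v| := by
      rw [← rhoSq_mul_time, abs_mul, abs_of_pos (rhoSq_pos a hr)]
    _ ≤ (rad x ^ 2 + a ^ 2) * |carterForm a x v|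
        + (rad x ^ 2 + a ^ 2) / 2 * |carterForm a x v| := by
      refine (abs_add_le _ _).trans (add_le_add (le_of_eq ?_) hα)
      rw [abs_mul, abs_of_nonneg (by positivity)]
    _ ≤ rad x ^ 2 * (3 * |carterForm a x v|) := by
      linarith [mul_le_mul_of_nonneg_right har (abs_nonneg (carterForm a x v))]

lemma abs_dr_le_abs_carterForm (hM : |a| < M) (hx : x ∈ exterior M a)
    (hn : metric M a x v v = 0) : |dr x v| ≤ |carterForm a x v| := by
  have hr := rad_pos_of_mem hM hx
  refine le_of_mul_le_mul_left ?_ (rhoSq_pos a hr)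
  calc rhoSq a x * |dr x v| = |radialMomentum a x v| := by
        rw [radialMomentum, abs_mul, abs_of_pos (rhoSq_pos a hr)]
    _ ≤ Delta M a (rad x) * |carterForm a x v| := abs_radialMomentum_le hM hx hn
    _ ≤ rhoSq a x * |carterForm a x v| := by
      gcongr
      exact (Delta_le_sq hM.le (abs_lt_rad hM hx).le).trans (rad_sq_le_rhoSq a x)

lemma rad_sq_mul_sphereMetric_le (hM : |a| < M) (hx : x ∈ exterior M a)
    (hn : metric M a x v v = 0) :
    rad x ^ 2 * sphereMetric x v v ≤ 4 * carterForm a x v ^ 2 := by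
  have hr := rad_pos_of_mem hM hx
  have har := sq_le_rad_sq hM hx
  have hK := carterK_le hM hx hn
  have hΔr := Delta_le_sq hM.le (abs_lt_rad hM hx).le
  have hα : a * azimuthalForm a x v * carterForm a x v ≤ rad x ^ 2 * carterForm a x v ^ 2 :=
    calc a * azimuthalForm a x v * carterForm a x v
        ≤ |a * azimuthalForm a x v| * |carterForm a x v| :=
          (le_abs_self _).trans_eq (abs_mul _ _)
      _ ≤ rad x ^ 2 * |carterForm a x v| * |carterForm a x v| := by
        gcongr
        refine (abs_mul_azimuthalForm_le hM hx hn).trans ?_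
        gcongr
        linarith
      _ = rad x ^ 2 * carterForm a x v ^ 2 := by
        rw [mul_assoc, abs_mul_abs_self, sq (carterForm ..)]
  have hs : a ^ 2 * sinSqTheta x * carterForm a x v ^ 2 ≤ rad x ^ 2 * carterForm a x v ^ 2 := by
    gcongr
    exact (mul_le_of_le_one_right (sq_nonneg a) (sinSqTheta_le_one x)).trans har
  refine le_of_mul_le_mul_left ?_ (pow_pos hr 2)
  calc rad x ^ 2 * (rad x ^ 2 * sphereMetric x v v)
      = (rad x ^ 2) ^ 2 * sphereMetric x v v := by ring
    _ ≤ rhoSq a x ^ 2 * sphereMetric x v v := by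
      gcongr
      · exact sphereMetric_self_nonneg x v
      · exact rad_sq_le_rhoSq a x
    _ = carterK M a x v + 2 * (a * azimuthalForm a x v * carterForm a x v)
        + a ^ 2 * sinSqTheta x * carterForm a x v ^ 2 := by
      rw [rhoSq_sq_mul_sphereMetric, carterK_eq_angularForm hr (Delta_pos hM hx).ne' hn]
      ring
    _ ≤ rad x ^ 2 * (4 * carterForm a x v ^ 2) := by
      linarith [mul_le_mul_of_nonneg_right hΔr (sq_nonneg (carterForm a x v))]

lemma norm_le_of_abs_time_le {c : ℝ} (hc : 0 ≤ c) (h₀ : |v 0| ≤ c)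
    (hsq : v 1 ^ 2 + v 2 ^ 2 + v 3 ^ 2 ≤ c ^ 2) : ‖v‖ ≤ c := by
  have hspace : ∀ i : Fin 3, |v i.succ| ≤ c := fun i => by
    refine abs_le_of_sq_le_sq (hsq.trans' ?_) hc
    simpa [Fin.sum_univ_three] using
      Finset.single_le_sum (f := fun i : Fin 3 => v i.succ ^ 2)
        (fun _ _ => sq_nonneg _) (Finset.mem_univ i)
  exact (pi_norm_le_iff_of_nonneg hc).2 (Fin.cases h₀ hspace)

lemma norm_le_mul_abs_carterForm (hM : |a| < M) (hx : x ∈ exterior M a)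
    (hn : metric M a x v v = 0) : ‖v‖ ≤ 3 * |carterForm a x v| := by
  refine norm_le_of_abs_time_le (by positivity) (abs_time_le hM hx hn) ?_
  rw [sq_add_sq_add_sq_eq (rad_pos_of_mem hM hx), mul_pow, sq_abs]
  have hdr := sq_le_sq.2 (abs_dr_le_abs_carterForm hM hx hn)
  linarith [rad_sq_mul_sphereMetric_le hM hx hn, sq_nonneg (carterForm a x v)]

end NullVector

section Shell

variable {M a E L K r₁ r₂ : ℝ}

lemma AdmissibleIntegrals.exists_le_abs_radialP (hA : AdmissibleIntegrals a E L K) (hM : |a| < M)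
    (hr₁ : rPlus M a < r₁) :
    ∃ k > 0, ∀ r, r₁ ≤ r → Delta M a r * K ≤ radialP a E L r ^ 2 → k ≤ |radialP a E L r| := by
  have hr₁₀ : 0 < r₁ := (rPlus_pos hM).trans hr₁
  rcases hA.carter_nonneg.eq_or_lt with rfl | hK
  · refine ⟨r₁ ^ 2 * |E|, by have := hA.energy_ne_zero rfl; positivity, fun r hr _ => ?_⟩
    exact (hA.sq_mul_abs_energy_le_abs_radialP r).trans' (by gcongr)
  · refine ⟨√(Delta M a r₁ * K), Real.sqrt_pos.2 (mul_pos (Delta_pos hM hr₁) hK),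
      fun r hr hP => Real.sqrt_le_left (abs_nonneg _) |>.2 ?_⟩
    rw [sq_abs]
    exact (mul_le_mul_of_nonneg_right
      (Delta_le_Delta ((lt_rPlus hM).trans hr₁).le hr) hK.le).trans hP

lemma exists_le_abs_time (hM : |a| < M) (hA : AdmissibleIntegrals a E L K)
    (hr₁ : rPlus M a < r₁) (hr₁₂ : r₁ ≤ r₂) :
    ∃ c > 0, ∀ x v, rad x ∈ Set.Icc r₁ r₂ → metric M a x v v = 0 → energy M a x v = E →
      angMom M a x v = L → carterK M a x v = K → c ≤ |v 0| := by
  obtain ⟨k, hk, hkP⟩ := hA.exists_le_abs_radialP hM hr₁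
  have hr₂ : 0 < r₂ := (rPlus_pos hM).trans (hr₁.trans_le hr₁₂)
  refine ⟨k / (2 * r₂ ^ 2), by positivity, fun x v hrx hn hE hL hK => ?_⟩
  have hx : x ∈ exterior M a := hr₁.trans_le hrx.1
  have hr := rad_pos_of_mem hM hx
  have hΔ := Delta_pos hM hx
  have hP := radialP_energy_angMom M a hr v
  have hPK := Delta_mul_carterK hr hΔ.ne' hn
  rw [hE, hL] at hP hPK
  rw [hK] at hPK
  have hle := hkP _ hrx.1 (by linarith [sq_nonneg (radialMomentum a x v)])
  rw [div_le_iff₀ (by positivity)]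
  calc k ≤ Delta M a (rad x) * |carterForm a x v| := by
        rwa [hP, abs_mul, abs_of_pos hΔ] at hle
    _ ≤ r₂ ^ 2 * (2 * |v 0|) := by
      gcongr
      · exact (Delta_le_sq hM.le (abs_lt_rad hM hx).le).trans (by gcongr; exact hrx.2)
      · exact abs_carterForm_le hM hx hn
    _ = |v 0| * (2 * r₂ ^ 2) := by ring

lemma exists_norm_le (hM : |a| < M) (E L r₂ : ℝ) (hr₁ : rPlus M a < r₁) :
    ∃ C, ∀ x v, rad x ∈ Set.Icc r₁ r₂ → metric M a x v v = 0 → energy M a x v = E →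
      angMom M a x v = L → ‖v‖ ≤ C := by
  refine ⟨3 * (((r₂ ^ 2 + a ^ 2) * |E| + |a * L|) / Delta M a r₁), fun x v hrx hn hE hL => ?_⟩
  have hx : x ∈ exterior M a := hr₁.trans_le hrx.1
  have hr := rad_pos_of_mem hM hx
  have hP := radialP_energy_angMom M a hr v
  rw [hE, hL] at hP
  refine (norm_le_mul_abs_carterForm hM hx hn).trans ?_
  gcongr
  rw [le_div_iff₀ (Delta_pos hM hr₁)]
  calc |carterForm a x v| * Delta M a r₁ ≤ |carterForm a x v| * Delta M a (rad x) := by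
        gcongr
        exact Delta_le_Delta ((lt_rPlus hM).trans hr₁).le hrx.1
    _ = |(rad x ^ 2 + a ^ 2) * E - a * L| := by
      rw [← radialP, hP, abs_mul, abs_of_pos (Delta_pos hM hx), mul_comm]
    _ ≤ (rad x ^ 2 + a ^ 2) * |E| + |a * L| :=
      (abs_sub _ _).trans_eq (by rw [abs_mul, abs_of_nonneg (by positivity)])
    _ ≤ (r₂ ^ 2 + a ^ 2) * |E| + |a * L| := by
      gcongr
      exact hrx.2

lemma isCompact_shell (r₁ r₂ B : ℝ) : IsCompact {x : Pt | rad x ∈ Set.Icc r₁ r₂ ∧ |x 0| ≤ B} := by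
  refine Metric.isCompact_of_isClosed_isBounded ?_ ?_
  · exact (isClosed_Icc.preimage continuous_rad).inter
      (isClosed_le (continuous_apply (0 : Fin 4)).abs continuous_const)
  · refine (Metric.isBounded_closedBall (x := (0 : Pt)) (r := max B r₂)).subset ?_
    rintro x ⟨⟨-, hx⟩, hB⟩
    have hr₂ : 0 ≤ r₂ := (Real.sqrt_nonneg _).trans hx
    refine mem_closedBall_zero_iff.2 (norm_le_of_abs_time_le (le_max_of_le_right hr₂)
      (le_max_of_le_left hB) ?_)
    rw [← rad_sq]
    exact pow_le_pow_left₀ (Real.sqrt_nonneg _) (le_max_of_le_right hx) 2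

end Shell

section Time

variable {M a : ℝ} {γ : ℝ → Pt} {sm sp : EReal}

/-- By `abs_dr_le`, `log (r - r₊)` changes by at most `2 / M` times the variation of `t`. -/
lemma IsGeodesicOn.exists_shell_of_le (hM : |a| < M) {J : Set ℝ} (hJ : IsOpen J)
    (hJ' : J.OrdConnected) (hg : IsGeodesicOn M a γ J)
    (hn : ∀ s ∈ J, metric M a (γ s) (deriv γ s) (deriv γ s) = 0) {τ : ℝ → ℝ}
    (hτ : ∀ s ∈ J, HasDerivAt τ |deriv γ s 0| s) {T s₀ : ℝ} (hs₀ : s₀ ∈ J)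
    (hT : ∀ s ∈ J, τ s ≤ T) :
    ∃ r₁ r₂, rPlus M a < r₁ ∧ r₁ ≤ r₂ ∧ ∀ s ∈ J, s₀ ≤ s → rad (γ s) ∈ Set.Icc r₁ r₂ := by
  have hM₀ := pos_of_abs_lt hM
  have hpos : ∀ s ∈ J, 0 < rad (γ s) - rPlus M a := fun s hs => sub_pos.2 (hg.1 s hs)
  have hlog : ∀ s ∈ J, HasDerivAt (fun s => Real.log (rad (γ s) - rPlus M a))
      (dr (γ s) (deriv γ s) / (rad (γ s) - rPlus M a)) s := fun s hs =>
    ((hg.hasDerivAt_rad hM hJ hs).sub_const _).log (hpos s hs).ne'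
  have hbound : ∀ s ∈ J, ‖dr (γ s) (deriv γ s) / (rad (γ s) - rPlus M a)‖
      ≤ 2 / M * |deriv γ s 0| := fun s hs => by
    rw [Real.norm_eq_abs, abs_div, abs_of_pos (hpos s hs), div_le_iff₀ (hpos s hs)]
    exact (abs_dr_le hM (hg.1 s hs) (hn s hs)).trans_eq (by ring)
  set l := Real.log (rad (γ s₀) - rPlus M a)
  set w := 2 / M * (T - τ s₀)
  have hw : 0 ≤ w := mul_nonneg (by positivity) (sub_nonneg.2 (hT s₀ hs₀))
  refine ⟨rPlus M a + Real.exp (l - w), rPlus M a + Real.exp (l + w),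
    lt_add_of_pos_right _ (Real.exp_pos _), by gcongr; linarith, fun s hs hle => ?_⟩
  have hvar : |Real.log (rad (γ s) - rPlus M a) - l| ≤ w :=
    (norm_sub_le_sub_of_norm_deriv_le hJ' hlog (fun u hu => (hτ u hu).const_mul (2 / M)) hbound
      hs₀ hs hle).trans ((mul_sub _ _ _).symm.trans_le
        (mul_le_mul_of_nonneg_left (sub_le_sub_right (hT s hs) _) (by positivity)))
  rw [abs_sub_le_iff] at hvar
  rw [Set.mem_Icc, ← le_sub_iff_add_le', ← sub_le_iff_le_add', ← Real.le_log_iff_exp_le (hpos s hs),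
    ← Real.log_le_iff_le_exp (hpos s hs)]
  constructor <;> linarith

namespace IsMaximalNullGeodesic

lemma exists_hasIntegrals (h : IsMaximalNullGeodesic M a γ sm sp) (hM : |a| < M) :
    ∃ E L K, AdmissibleIntegrals a E L K ∧ HasIntegrals M a γ (interval sm sp) E L K :=
  h.geodesic.exists_hasIntegrals hM (isOpen_interval _ _) (ordConnected_interval _ _)
    (nonempty_interval h.lt) h.null

lemma eq_top_of_rad_mem_Icc (h : IsMaximalNullGeodesic M a γ sm sp) (hM : |a| < M) {r₁ r₂ s₀ : ℝ}
    (hr₁ : rPlus M a < r₁) (hs₀ : s₀ ∈ interval sm sp)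
    (hr : ∀ s ∈ interval sm sp, s₀ ≤ s → rad (γ s) ∈ Set.Icc r₁ r₂) : sp = ⊤ := by
  induction sp with
  | bot => exact absurd h.lt not_lt_bot
  | top => rfl
  | coe b =>
    exfalso
    obtain ⟨E, L, K, -, hI⟩ := h.exists_hasIntegrals hM
    obtain ⟨C, hC⟩ := exists_norm_le (a := a) hM E L r₂ hr₁
    have hmem : Set.Ico s₀ b ⊆ interval sm b := fun s hs =>
      ⟨hs₀.1.trans_le (EReal.coe_le_coe hs.1), EReal.coe_lt_coe hs.2⟩
    have hspeed : ∀ s ∈ Set.Ico s₀ b, ‖deriv γ s‖ ≤ C := fun s hs =>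
      hC _ _ (hr s (hmem hs) hs.1) (h.null s (hmem hs)).2 (hI.energy_eq s (hmem hs))
        (hI.angMom_eq s (hmem hs))
    have hs₀b : s₀ ∈ Set.Ico s₀ b := ⟨le_rfl, EReal.coe_lt_coe_iff.1 hs₀.2⟩
    have hC₀ : 0 ≤ C := (norm_nonneg _).trans (hspeed s₀ hs₀b)
    obtain ⟨s, hs, hnot⟩ := h.exists_notMem_of_isCompact hM hs₀
      ((isCompact_shell r₁ r₂ (|γ s₀ 0| + C * (b - s₀))).prod (isCompact_closedBall (0 : Pt) C))
      fun z hz => ⟨hr₁.trans_le hz.1.1.1, trivial⟩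
    have hs' := Set.Ioo_subset_Ico_self hs
    refine hnot ⟨⟨hr s (hmem hs') hs'.1, ?_⟩, mem_closedBall_zero_iff.2 (hspeed s hs')⟩
    have htime : |γ s 0 - γ s₀ 0| ≤ C * (b - s₀) :=
      calc |γ s 0 - γ s₀ 0| ≤ ‖γ s - γ s₀‖ := norm_le_pi_norm (γ s - γ s₀) 0
        _ ≤ C * s - C * s₀ := norm_sub_le_sub_of_norm_deriv_le Set.ordConnected_Ico
          (fun u hu => h.geodesic.hasDerivAt (isOpen_interval _ _) (hmem hu))
          (fun u _ => hasDerivAt_const_mul C) hspeed hs₀b hs' hs'.1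
        _ ≤ C * (b - s₀) := by rw [← mul_sub]; gcongr; exact hs.2.le
    linarith [abs_sub_abs_le_abs_sub (γ s 0) (γ s₀ 0)]

theorem exists_lt_of_hasDerivAt_abs (h : IsMaximalNullGeodesic M a γ sm sp) (hM : |a| < M)
    {τ : ℝ → ℝ} (hτ : ∀ s ∈ interval sm sp, HasDerivAt τ |deriv γ s 0| s) (T : ℝ) :
    ∃ s ∈ interval sm sp, T < τ s := by
  by_contra! hT
  have hJ := isOpen_interval sm sp
  have hJ' := ordConnected_interval sm sp
  obtain ⟨s₀, hs₀⟩ := nonempty_interval h.lt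
  obtain ⟨r₁, r₂, hr₁, hr₁₂, hr⟩ :=
    h.geodesic.exists_shell_of_le hM hJ hJ' (fun s hs => (h.null s hs).2) hτ hs₀ hT
  obtain ⟨E, L, K, hA, hI⟩ := h.exists_hasIntegrals hM
  obtain ⟨c, hc, hct⟩ := exists_le_abs_time hM hA hr₁ hr₁₂
  obtain rfl : sp = ⊤ := h.eq_top_of_rad_mem_Icc hM hr₁ hs₀ hr
  set s := s₀ + ((T - τ s₀) / c + 1)
  have hs₀s : s₀ ≤ s := le_add_of_nonneg_right
    (add_nonneg (div_nonneg (sub_nonneg.2 (hT s₀ hs₀)) hc.le) zero_le_one)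
  have hs : s ∈ interval sm ⊤ := ⟨hs₀.1.trans_le (EReal.coe_le_coe hs₀s), EReal.coe_lt_top s⟩
  have hgrowth : ‖c * s - c * s₀‖ ≤ τ s - τ s₀ :=
    norm_sub_le_sub_of_norm_deriv_le (hJ'.inter Set.ordConnected_Ici)
      (fun u _ => hasDerivAt_const_mul c) (fun u hu => hτ u hu.1)
      (fun u hu => by
        rw [Real.norm_of_nonneg hc.le]
        exact hct _ _ (hr u hu.1 hu.2) (h.null u hu.1).2 (hI.energy_eq u hu.1)
          (hI.angMom_eq u hu.1) (hI.carterK_eq u hu.1))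
      ⟨hs₀, Set.self_mem_Ici⟩ ⟨hs, hs₀s⟩ hs₀s
  have hval : c * s - c * s₀ = T - τ s₀ + c := by
    simp only [s]
    field_simp
    ring
  linarith [hT s hs, Real.le_norm_self (c * s - c * s₀)]

end IsMaximalNullGeodesic

lemma eventually_futureEnd {s₁ : ℝ} (hs₁ : s₁ ∈ interval sm sp) :
    ∀ᶠ s in futureEnd sp, s ∈ interval sm sp ∧ s₁ ≤ s := by
  filter_upwards [preimage_mem_comap (Ioo_mem_nhdsLT hs₁.2)] with s hs
  exact ⟨⟨hs₁.1.trans hs.1, hs.2⟩, (EReal.coe_lt_coe_iff.1 hs.1).le⟩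

lemma eventually_pastEnd {s₁ : ℝ} (hs₁ : s₁ ∈ interval sm sp) :
    ∀ᶠ s in pastEnd sm, s ∈ interval sm sp ∧ s ≤ s₁ := by
  filter_upwards [preimage_mem_comap (Ioo_mem_nhdsGT hs₁.1)] with s hs
  exact ⟨⟨hs.1, hs.2.trans hs₁.2⟩, (EReal.coe_lt_coe_iff.1 hs.2).le⟩

namespace IsFutureNullGeodesic

lemma hasDerivAt_time (h : IsFutureNullGeodesic M a γ sm sp) {s : ℝ} (hs : s ∈ interval sm sp) :
    HasDerivAt (fun s => γ s 0) |deriv γ s 0| s := by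
  rw [abs_of_pos (h.future s hs)]
  exact hasDerivAt_pi.1 (h.geodesic.hasDerivAt (isOpen_interval _ _) hs) 0

lemma monotoneOn_time (h : IsFutureNullGeodesic M a γ sm sp) :
    MonotoneOn (fun s => γ s 0) (interval sm sp) := fun u hu w hw hle =>
  sub_nonneg.1 <| (norm_nonneg (0 : ℝ)).trans <| by
    simpa using norm_sub_le_sub_of_norm_deriv_le (f := fun _ => (0 : ℝ))
      (ordConnected_interval sm sp) (fun s _ => hasDerivAt_const s 0)
      (fun s hs => h.hasDerivAt_time hs) (fun s _ => by simp) hu hw hle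

theorem tendsto_time_futureEnd (h : IsFutureNullGeodesic M a γ sm sp) (hM : |a| < M) :
    Tendsto (fun s => γ s 0) (futureEnd sp) atTop := by
  refine tendsto_atTop.2 fun T => ?_
  obtain ⟨s₁, hs₁, hT⟩ :=
    h.isMaximal.exists_lt_of_hasDerivAt_abs hM (fun s hs => h.hasDerivAt_time hs) T
  filter_upwards [eventually_futureEnd hs₁] with s hs
  exact hT.le.trans (h.monotoneOn_time hs₁ hs.1 hs.2)

theorem tendsto_time_pastEnd (h : IsFutureNullGeodesic M a γ sm sp) (hM : |a| < M) :
    Tendsto (fun s => γ s 0) (pastEnd sm) atBot := by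
  refine tendsto_atBot.2 fun T => ?_
  have hmem {s : ℝ} (hs : s ∈ interval (-sp) (-sm)) : -s ∈ interval sm sp :=
    (neg_preimage_interval sm sp).ge hs
  obtain ⟨s₁, hs₁, hT⟩ := h.isMaximal.comp_neg.exists_lt_of_hasDerivAt_abs hM
    (τ := fun s => -γ (-s) 0) (fun s hs => by
      rw [deriv_comp_neg, Pi.neg_apply, abs_neg]
      exact ((h.hasDerivAt_time (hmem hs)).scomp s (hasDerivAt_neg s)).fun_neg.congr_deriv
        (by simp)) (-T)
  filter_upwards [eventually_pastEnd (hmem hs₁)] with s hs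
  exact (h.monotoneOn_time hs.1 (hmem hs₁) hs.2).trans (neg_lt_neg_iff.1 hT).le

end IsFutureNullGeodesic

theorem tendsto_tortoise (hM : |a| < M) :
    Tendsto (tortoise M a) (𝓝[≠] rPlus M a) atBot := by
  have hlt := rMinus_lt_rPlus hM
  have hκ : 0 < 1 / (2 * kappaPlus M a) := by
    have hr := rPlus_pos hM
    exact one_div_pos.2 (mul_pos two_pos (div_pos (sub_pos.2 hlt) (by positivity)))
  have hshift : Tendsto (fun r => r - rPlus M a) (𝓝[≠] rPlus M a) (𝓝[≠] 0) := by
    refine tendsto_nhdsWithin_iff.2 ⟨?_, ?_⟩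
    · exact (tendsto_sub_nhds_zero_iff.2 tendsto_id).mono_left nhdsWithin_le_nhds
    · filter_upwards [self_mem_nhdsWithin] with r hr using sub_ne_zero.2 hr
  have hlog : Tendsto (fun r => Real.log |r - rPlus M a|) (𝓝[≠] rPlus M a) atBot := by
    simp only [Real.log_abs]
    exact Real.tendsto_log_nhdsNE_zero.comp hshift
  have hrest : ContinuousAt (fun r => r + 1 / (2 * kappaMinus M a) * Real.log |r - rMinus M a|)
      (rPlus M a) :=
    continuousAt_id.add (continuousAt_const.mul
      (ContinuousAt.log (by fun_prop) (abs_ne_zero.2 (sub_ne_zero.2 hlt.ne'))))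
  refine ((hlog.const_mul_atBot hκ).atBot_add
    (hrest.tendsto.mono_left nhdsWithin_le_nhds)).congr fun r => ?_
  rw [tortoise]
  ring

theorem IsFutureNullGeodesic.tendsto_tStar_pastEnd (h : IsFutureNullGeodesic M a γ sm sp)
    (hM : |a| < M) (hs : StartsAtHorizon M a γ sm) :
    Tendsto (fun s => tStar M a (γ s)) (pastEnd sm) atBot := by
  obtain ⟨s₀, hs₀⟩ := nonempty_interval h.lt
  have hne : Tendsto (fun s => rad (γ s)) (pastEnd sm) (𝓝[≠] rPlus M a) := by
    refine tendsto_nhdsWithin_iff.2 ⟨hs, ?_⟩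
    filter_upwards [eventually_pastEnd hs₀] with s hs
    exact (h.geodesic.1 s hs.1).ne'
  exact (h.tendsto_time_pastEnd hM).atBot_add_atBot ((tendsto_tortoise hM).comp hne)

end Time

section RadialMotion

/-- One-dimensional motion with `ρ r' = w`, `ρ w' = S(r)` and the conserved relation `w² = R(r)`.
For the radial motion of a null geodesic `ρ` is `r² + a² cos² θ`, `R` is the radial potential and
`S` is `R' / 2`. -/
structure IsRadialMotion (R S r w ρ : ℝ → ℝ) (J : Set ℝ) : Prop where
  pos : ∀ s ∈ J, 0 < ρ s
  hasDerivAt_radius : ∀ s ∈ J, HasDerivAt r (w s / ρ s) s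
  hasDerivAt_momentum : ∀ s ∈ J, HasDerivAt w (S (r s) / ρ s) s
  momentum_sq : ∀ s ∈ J, w s ^ 2 = R (r s)

namespace IsRadialMotion

variable {R S r w ρ : ℝ → ℝ} {J : Set ℝ}

lemma mono {J' : Set ℝ} (h : IsRadialMotion R S r w ρ J) (hJ : J' ⊆ J) :
    IsRadialMotion R S r w ρ J' where
  pos s hs := h.pos s (hJ hs)
  hasDerivAt_radius s hs := h.hasDerivAt_radius s (hJ hs)
  hasDerivAt_momentum s hs := h.hasDerivAt_momentum s (hJ hs)
  momentum_sq s hs := h.momentum_sq s (hJ hs)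

/-- `ζ w` is strictly decreasing at each of its zeros, so it vanishes at most once. -/
lemma exists_momentum_nonneg_or_nonpos (h : IsRadialMotion R S r w ρ J) (hJ : IsOpen J)
    (hJ' : J.OrdConnected) (hne : J.Nonempty) {ζ : ℝ}
    (hS : ∀ s ∈ J, R (r s) = 0 → ζ * S (r s) < 0) :
    ∃ s₂ ∈ J, (∀ s ∈ J, s ≤ s₂ → 0 ≤ w s) ∨ ∀ s ∈ J, s ≤ s₂ → w s ≤ 0 := by
  have hR : ∀ s ∈ J, w s = 0 → R (r s) = 0 := fun s hs h₀ => by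
    rw [← h.momentum_sq s hs, h₀, zero_pow two_ne_zero]
  have huniq : ∀ u ∈ J, ∀ v ∈ J, u < v → w u = 0 → w v ≠ 0 := fun u hu v hv huv hu₀ hv₀ => by
    have hζ : ζ ≠ 0 := left_ne_zero_of_mul (hS u hu (hR u hu hu₀)).ne
    have hsub := hJ'.out hu hv
    refine (neg_of_deriv_neg_at_zeros huv
      (fun s hs => (h.hasDerivAt_momentum s (hsub hs)).const_mul ζ) (fun s hs hs₀ => ?_)
      (by rw [hu₀, mul_zero])).ne (by rw [hv₀, mul_zero])
    rw [← mul_div_assoc]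
    exact div_neg_of_neg_of_pos
      (hS s (hsub hs) (hR s (hsub hs) ((mul_eq_zero.1 hs₀).resolve_left hζ))) (h.pos s (hsub hs))
  obtain ⟨s₁, hs₁, hsgn⟩ := exists_sign_of_eq_zero_unique hJ' hne
    (fun s hs => (h.hasDerivAt_momentum s hs).continuousAt.continuousWithinAt) huniq
  obtain ⟨s₂, hs₂, hlt⟩ :=
    ((eventually_nhdsWithin_of_eventually_nhds (hJ.mem_nhds hs₁)).and
      (self_mem_nhdsWithin (s := Set.Iio s₁))).exists
  exact ⟨s₂, hs₂, hsgn.imp (fun hw s hs hle => (hw s hs (hle.trans_lt hlt)).le)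
    fun hw s hs hle => (hw s hs (hle.trans_lt hlt)).le⟩

lemma monotoneOn (h : IsRadialMotion R S r w ρ J) (hJ : J.OrdConnected)
    (hw : ∀ s ∈ J, 0 ≤ w s) : MonotoneOn r J :=
  monotoneOn_of_hasDerivWithinAt_nonneg hJ.convex
    (fun s hs => (h.hasDerivAt_radius s hs).continuousAt.continuousWithinAt)
    (fun s hs => (h.hasDerivAt_radius s (interior_subset hs)).hasDerivWithinAt)
    fun s hs => div_nonneg (hw s (interior_subset hs)) (h.pos s (interior_subset hs)).le

lemma antitoneOn (h : IsRadialMotion R S r w ρ J) (hJ : J.OrdConnected)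
    (hw : ∀ s ∈ J, w s ≤ 0) : AntitoneOn r J :=
  antitoneOn_of_hasDerivWithinAt_nonpos hJ.convex
    (fun s hs => (h.hasDerivAt_radius s hs).continuousAt.continuousWithinAt)
    (fun s hs => (h.hasDerivAt_radius s (interior_subset hs)).hasDerivWithinAt)
    fun s hs =>
      div_nonpos_of_nonpos_of_nonneg (hw s (interior_subset hs)) (h.pos s (interior_subset hs)).le

/-- `r` and `w` converge at `-∞`, and so do `ρ r'` and `ρ w'`; as `ρ` is bounded, the limits of the
latter two are `0`. -/
theorem exists_tendsto_double_zero {s₂ r₁ r₂ N : ℝ}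
    (h : IsRadialMotion R S r w ρ (Set.Iic s₂)) (hR : Continuous R) (hS : Continuous S)
    (hw : (∀ s ≤ s₂, 0 ≤ w s) ∨ ∀ s ≤ s₂, w s ≤ 0) (hr : ∀ s ≤ s₂, r s ∈ Set.Icc r₁ r₂)
    (hρ : ∀ s ≤ s₂, ρ s ≤ N) : ∃ l, Tendsto r atBot (𝓝 l) ∧ R l = 0 ∧ S l = 0 := by
  have hρ' : ∀ s ≤ s₂, 0 < ρ s ∧ ρ s ≤ N := fun s hs => ⟨h.pos s hs, hρ s hs⟩
  obtain ⟨l, hl⟩ : ∃ l, Tendsto r atBot (𝓝 l) := by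
    rcases hw with hw | hw
    · exact exists_tendsto_atBot_of_monotoneOn (h.monotoneOn Set.ordConnected_Iic hw)
        fun s hs => (hr s hs).1
    · obtain ⟨l, hl⟩ := exists_tendsto_atBot_of_monotoneOn
        (h.antitoneOn Set.ordConnected_Iic hw).neg fun s hs => neg_le_neg (hr s hs).2
      exact ⟨-l, by simpa only [Pi.neg_apply, neg_neg] using hl.neg⟩
  have hsqrt : Tendsto (fun s => √(R (r s))) atBot (𝓝 √(R l)) := ((hR.tendsto l).comp hl).sqrt
  obtain ⟨W, hW⟩ : ∃ W, Tendsto w atBot (𝓝 W) := by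
    rcases hw with hw | hw
    · refine ⟨√(R l), hsqrt.congr' ?_⟩
      filter_upwards [eventually_le_atBot s₂] with s hs
      rw [← h.momentum_sq s hs, Real.sqrt_sq (hw s hs)]
    · refine ⟨-√(R l), hsqrt.neg.congr' ?_⟩
      filter_upwards [eventually_le_atBot s₂] with s hs
      rw [← h.momentum_sq s hs, Real.sqrt_sq_eq_abs, abs_of_nonpos (hw s hs), neg_neg]
  obtain rfl : W = 0 := eq_zero_of_tendsto_of_hasDerivAt_div h.hasDerivAt_radius hρ' hl hW
  refine ⟨l, hl, ?_, eq_zero_of_tendsto_of_hasDerivAt_div h.hasDerivAt_momentum hρ' hW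
    ((hS.tendsto l).comp hl)⟩
  refine tendsto_nhds_unique ((hR.tendsto l).comp hl) ((hW.pow 2).congr' ?_) |>.trans
    (zero_pow two_ne_zero)
  filter_upwards [eventually_le_atBot s₂] with s hs using h.momentum_sq s hs

end IsRadialMotion

end RadialMotion

section Start

variable {M a E L K : ℝ} {γ : ℝ → Pt} {sm sp : EReal}

theorem HasIntegrals.isRadialMotion {J : Set ℝ} (hI : HasIntegrals M a γ J E L K) (hM : |a| < M)
    (hJ : IsOpen J) (hg : IsGeodesicOn M a γ J)
    (hn : ∀ s ∈ J, metric M a (γ s) (deriv γ s) (deriv γ s) = 0) :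
    IsRadialMotion (fun r => radialP a E L r ^ 2 - Delta M a r * K)
      (fun r => radialSlope M a E L K r / 2) (fun s => rad (γ s))
      (fun s => radialMomentum a (γ s) (deriv γ s)) (fun s => rhoSq a (γ s)) J := by
  have hr {s : ℝ} (hs : s ∈ J) := rad_pos_of_mem hM (hg.1 s hs)
  refine ⟨fun s hs => rhoSq_pos a (hr hs), fun s hs => ?_, fun s hs => ?_, fun s hs => ?_⟩
  · exact (hg.hasDerivAt_rad hM hJ hs).congr_deriv
      (mul_div_cancel_left₀ _ (rhoSq_pos a (hr hs)).ne').symm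
  · have hw := hg.hasDerivAt_radialMomentum hM hJ hs (hn s hs)
    rwa [hI.energy_eq s hs, hI.angMom_eq s hs, hI.carterK_eq s hs, ← div_div] at hw
  · have hK := Delta_mul_carterK (hr hs) (Delta_pos hM (hg.1 s hs)).ne' (hn s hs)
    rw [hI.energy_eq s hs, hI.angMom_eq s hs, hI.carterK_eq s hs] at hK
    rw [hK]
    ring

lemma exists_le_rad_of_not_startsAtHorizon (hγ : ∀ s ∈ interval sm sp, γ s ∈ exterior M a)
    (h : ¬ StartsAtHorizon M a γ sm) {s₂ : ℝ} (hs₂ : s₂ ∈ interval sm sp)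
    (hmono : MonotoneOn (fun s => rad (γ s)) (interval sm sp ∩ Set.Iic s₂)) :
    ∃ r₁, rPlus M a < r₁ ∧ ∀ s ∈ interval sm sp, s ≤ s₂ → r₁ ≤ rad (γ s) := by
  contrapose! h
  refine tendsto_order.2 ⟨fun b hb => ?_, fun b hb => ?_⟩
  · filter_upwards [eventually_pastEnd hs₂] with s hs using hb.trans (hγ s hs.1)
  · obtain ⟨s₃, hs₃, hle, hlt⟩ := h b hb
    filter_upwards [eventually_pastEnd hs₃] with s hs
    exact (hmono ⟨hs.1, hs.2.trans hle⟩ ⟨hs₃, hle⟩ hs.2).trans_lt hlt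

lemma exists_rad_le_of_not_startsAtInfinity (h : ¬ StartsAtInfinity γ sm) {s₂ : ℝ}
    (hanti : AntitoneOn (fun s => rad (γ s)) (interval sm sp ∩ Set.Iic s₂)) :
    ∃ r₂, ∀ s ∈ interval sm sp, s ≤ s₂ → rad (γ s) ≤ r₂ := by
  contrapose! h
  refine tendsto_atTop.2 fun b => ?_
  obtain ⟨s₃, hs₃, hle, hlt⟩ := h b
  filter_upwards [eventually_pastEnd hs₃] with s hs
  exact hlt.le.trans (hanti ⟨hs.1, hs.2.trans hle⟩ ⟨hs₃, hle⟩ hs.2)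

namespace IsMaximalNullGeodesic

lemma eq_bot_of_rad_mem_Icc (h : IsMaximalNullGeodesic M a γ sm sp) (hM : |a| < M) {r₁ r₂ s₂ : ℝ}
    (hr₁ : rPlus M a < r₁) (hs₂ : s₂ ∈ interval sm sp)
    (hr : ∀ s ∈ interval sm sp, s ≤ s₂ → rad (γ s) ∈ Set.Icc r₁ r₂) : sm = ⊥ := by
  have hmem {s : ℝ} : -s ∈ interval sm sp ↔ s ∈ interval (-sp) (-sm) :=
    Set.ext_iff.1 (neg_preimage_interval sm sp) s
  rw [← EReal.neg_eq_top_iff]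
  exact h.comp_neg.eq_top_of_rad_mem_Icc hM hr₁ (hmem.1 ((neg_neg s₂).symm ▸ hs₂))
    fun s hs hle => hr (-s) (hmem.2 hs) (neg_le.1 hle)

lemma exists_rad_mem_Icc_of_not_startsAt (h : IsMaximalNullGeodesic M a γ sm sp)
    (h₁ : ¬ StartsAtHorizon M a γ sm) (h₂ : ¬ StartsAtInfinity γ sm) {R S w ρ : ℝ → ℝ}
    (hγ : IsRadialMotion R S (fun s => rad (γ s)) w ρ (interval sm sp)) {s₂ : ℝ}
    (hs₂ : s₂ ∈ interval sm sp)
    (hw : (∀ s ∈ interval sm sp, s ≤ s₂ → 0 ≤ w s) ∨ ∀ s ∈ interval sm sp, s ≤ s₂ → w s ≤ 0) :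
    ∃ r₁ r₂, rPlus M a < r₁ ∧ ∀ s ∈ interval sm sp, s ≤ s₂ → rad (γ s) ∈ Set.Icc r₁ r₂ := by
  have hpast := hγ.mono (Set.inter_subset_left (t := Set.Iic s₂))
  have hconn := (ordConnected_interval sm sp).inter (Set.ordConnected_Iic (a := s₂))
  rcases hw with hw | hw
  · have hmono := hpast.monotoneOn hconn fun s hs => hw s hs.1 hs.2
    obtain ⟨r₁, hr₁, hr⟩ := exists_le_rad_of_not_startsAtHorizon h.geodesic.1 h₁ hs₂ hmono
    exact ⟨r₁, rad (γ s₂), hr₁, fun s hs hle =>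
      ⟨hr s hs hle, hmono ⟨hs, hle⟩ ⟨hs₂, Set.self_mem_Iic⟩ hle⟩⟩
  · have hanti := hpast.antitoneOn hconn fun s hs => hw s hs.1 hs.2
    obtain ⟨r₂, hr⟩ := exists_rad_le_of_not_startsAtInfinity h₂ hanti
    exact ⟨rad (γ s₂), r₂, h.geodesic.1 s₂ hs₂, fun s hs hle =>
      ⟨hanti ⟨hs, hle⟩ ⟨hs₂, Set.self_mem_Iic⟩ hle, hr s hs hle⟩⟩

theorem startsAtHorizon_or_startsAtInfinity (h : IsMaximalNullGeodesic M a γ sm sp)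
    (hM : |a| < M) (hI : HasIntegrals M a γ (interval sm sp) E L K) {Z : Set ℝ} (hZ : IsClosed Z)
    (hγZ : ∀ s ∈ interval sm sp, rad (γ s) ∈ Z) {ζ : ℝ}
    (hslope : ∀ r ∈ Z, rPlus M a < r → radialP a E L r ^ 2 = Delta M a r * K →
      ζ * radialSlope M a E L K r < 0) :
    StartsAtHorizon M a γ sm ∨ StartsAtInfinity γ sm := by
  by_contra! hcon
  have hJ := isOpen_interval sm sp
  have hmotion := hI.isRadialMotion hM hJ h.geodesic fun s hs => (h.null s hs).2
  obtain ⟨s₂, hs₂, hw⟩ := hmotion.exists_momentum_nonneg_or_nonpos hJ (ordConnected_interval sm sp)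
    (nonempty_interval h.lt) (ζ := ζ) fun s hs hR => by
      linarith [hslope _ (hγZ s hs) (h.geodesic.1 s hs) (sub_eq_zero.1 hR)]
  obtain ⟨r₁, r₂, hr₁, hr⟩ :=
    h.exists_rad_mem_Icc_of_not_startsAt hcon.1 hcon.2 hmotion hs₂ hw
  obtain rfl := h.eq_bot_of_rad_mem_Icc hM hr₁ hs₂ hr
  have hmem : Set.Iic s₂ ⊆ interval ⊥ sp := fun s hs =>
    ⟨EReal.bot_lt_coe s, (EReal.coe_le_coe hs).trans_lt hs₂.2⟩
  have hρ : ∀ s ≤ s₂, rhoSq a (γ s) ≤ r₂ ^ 2 + a ^ 2 := fun s hs => by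
    have hpos := rad_pos_of_mem hM (h.geodesic.1 s (hmem hs))
    exact (rhoSq_le a (γ s)).trans (by gcongr; exact (hr s (hmem hs) hs).2)
  obtain ⟨l, hl, hRl, hSl⟩ := (hmotion.mono hmem).exists_tendsto_double_zero
    (by unfold radialP Delta; fun_prop) (by unfold radialSlope radialP; fun_prop)
    (hw.imp (fun hw s hs => hw s (hmem hs) hs) fun hw s hs => hw s (hmem hs) hs)
    (fun s hs => hr s (hmem hs) hs) hρ
  have hlmem : l ∈ Z ∩ Set.Icc r₁ r₂ := (hZ.inter isClosed_Icc).mem_of_tendsto hl <|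
    (eventually_le_atBot s₂).mono fun s hs => ⟨hγZ s (hmem hs), hr s (hmem hs) hs⟩
  have hneg := hslope l hlmem.1 (hr₁.trans_le hlmem.2.1) (sub_eq_zero.1 hRl)
  rw [(div_eq_zero_iff.1 hSl).resolve_right two_ne_zero, mul_zero] at hneg
  exact lt_irrefl 0 hneg

theorem exists_eventually_isTimelike (h : IsMaximalNullGeodesic M a γ sm sp) (hM₀ : 0 < M)
    (hM : 100 * |a| ≤ M) (h₁ : ¬ StartsAtHorizon M a γ sm) (h₂ : ¬ StartsAtInfinity γ sm) :
    ∃ s ∈ interval sm sp, ∀ᶠ x in 𝓝 (γ s),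
      IsTimelike M a x (vH M a x) ∧ IsTimelike M a x vI := by
  have hM' : |a| < M := by linarith
  by_contra hcon
  obtain ⟨E, L, K, hA, hI⟩ := h.exists_hasIntegrals hM'
  have hcont : ContinuousOn (fun s => rad (γ s)) (interval sm sp) := fun s hs =>
    (h.geodesic.hasDerivAt_rad hM' (isOpen_interval _ _) hs).continuousAt.continuousWithinAt
  suffices hstart : StartsAtHorizon M a γ sm ∨ StartsAtInfinity γ sm from
    hstart.elim h₁ h₂
  rcases forall_le_or_forall_ge_of_notMem_Ioo (ordConnected_interval sm sp).isPreconnected hcont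
    (by linarith : 29 / 10 * M < 31 / 10 * M)
    fun s hs hr => hcon ⟨s, hs, eventually_isTimelike hM₀ hM hr.1 hr.2⟩ with hr | hr
  · refine h.startsAtHorizon_or_startsAtInfinity hM' hI isClosed_Iic hr (ζ := 1)
      fun r hrZ hrp hR => ?_
    rw [one_mul]
    exact hA.radialSlope_neg hM' hrp (by linarith [Set.mem_Iic.1 hrZ]) hR
  · refine h.startsAtHorizon_or_startsAtInfinity hM' hI isClosed_Ici hr (ζ := -1)
      fun r hrZ _ hR => ?_
    rw [neg_one_mul, neg_lt_zero]
    exact hA.radialSlope_pos hM' (by linarith [Set.mem_Ici.1 hrZ]) hR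

end IsMaximalNullGeodesic

end Start

end

end Kerr

theorem mainTheorem8 :
    -- behaviour of `t` and `t*` at the ends, for all subextremal parameters
    (∀ M a : ℝ, 0 < |a| → |a| < M →
      ∀ (γ : ℝ → Kerr.Pt) (sm sp : EReal), Kerr.IsFutureNullGeodesic M a γ sm sp →
        Filter.Tendsto (fun s => γ s 0) (Kerr.futureEnd sp) Filter.atTop ∧
        Filter.Tendsto (fun s => γ s 0) (Kerr.pastEnd sm) Filter.atBot ∧
        (Kerr.StartsAtHorizon M a γ sm →
          Filter.Tendsto (fun s => Kerr.tStar M a (γ s)) (Kerr.pastEnd sm) Filter.atBot)) ∧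
    -- for slow rotation, geodesics starting neither at `r₊` nor at infinity cross the region
    -- where both Killing fields are timelike
    (∃ a₀ : ℝ, 0 < a₀ ∧ a₀ ≤ 1 ∧ ∀ M a : ℝ, 0 < M → 0 < |a| → |a| / M < a₀ →
      ∀ (γ : ℝ → Kerr.Pt) (sm sp : EReal), Kerr.IsFutureNullGeodesic M a γ sm sp →
        ¬ Kerr.StartsAtHorizon M a γ sm → ¬ Kerr.StartsAtInfinity γ sm →
        ∃ s ∈ Kerr.interval sm sp, ∀ᶠ x in nhds (γ s),
          Kerr.IsTimelike M a x (Kerr.vH M a x) ∧ Kerr.IsTimelike M a x Kerr.vI) ∧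
    -- no double zeros of `R` between the horizons
    (∀ M a : ℝ, 0 < |a| → |a| < M → ∀ E L Q : ℝ, Kerr.AreNullIntegrals M a E L Q →
      ∀ r : ℝ, Kerr.rMinus M a < r → r < Kerr.rPlus M a →
        ¬ Kerr.IsDoubleZero M a E L Q r) ∧
    -- location of the double zeros of `R` for slow rotation
    (∃ a₀ C : ℝ, 0 < a₀ ∧ a₀ < 1 ∧ 0 < C ∧ ∀ M a : ℝ, 0 < M → 0 < |a| → |a| / M ≤ a₀ →
      ∀ E L Q : ℝ, Kerr.AreNullIntegrals M a E L Q → E ≠ 0 →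
      ∀ r : ℝ, Kerr.rMinus M a ≤ r → Kerr.IsDoubleZero M a E L Q r →
        r ∈ Set.Icc (3 * M - C * |a|) (3 * M + C * |a|) ∧
        |L / E| ≤ C * M ∧ |Q / E ^ 2| ≤ C * M ^ 2) ∧
    -- for slow rotation, both Killing fields are future directed timelike at the double zeros
    (∃ a₁ : ℝ, 0 < a₁ ∧ a₁ ≤ 1 ∧ ∀ M a : ℝ, 0 < M → 0 < |a| → |a| / M < a₁ →
      ∀ E L Q : ℝ, Kerr.AreNullIntegrals M a E L Q →
      ∀ x : Kerr.Pt, Kerr.rPlus M a ≤ Kerr.rad x → Kerr.IsDoubleZero M a E L Q (Kerr.rad x) →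
        x ∈ Kerr.exterior M a ∧
        (Kerr.IsTimelike M a x (Kerr.vH M a x) ∧ Kerr.IsFutureDirected (Kerr.vH M a x)) ∧
        (Kerr.IsTimelike M a x Kerr.vI ∧ Kerr.IsFutureDirected Kerr.vI)) := by
  have hslow : ∀ {M a ε : ℝ}, 0 < M → |a| / M ≤ ε → ε ≤ 1 / 100 → 100 * |a| ≤ M :=
    fun hM h hε => by linarith [(div_le_iff₀ hM).1 (h.trans hε)]
  refine ⟨fun M a _ hM γ sm sp h =>
      ⟨h.tendsto_time_futureEnd hM, h.tendsto_time_pastEnd hM, h.tendsto_tStar_pastEnd hM⟩,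
    ⟨1 / 100, by norm_num, by norm_num, fun M a hM _ haM γ sm sp h h₁ h₂ =>
      h.isMaximal.exists_eventually_isTimelike hM (hslow hM haM.le le_rfl) h₁ h₂⟩,
    fun M a _ hM E L Q h r h₁ h₂ => Kerr.not_isDoubleZero_between hM h h₁ h₂,
    ⟨1 / 100, 169, by norm_num, by norm_num, by norm_num, ?_⟩,
    ⟨1 / 100, by norm_num, by norm_num, ?_⟩⟩
  · intro M a hM ha haM E L Q h hE r hr hd
    have hM' := hslow hM haM le_rfl
    have haM' : |a| < M := by linarith
    obtain ⟨hrp, hr₁, hr₂⟩ := Kerr.rPlus_lt_and_mem_Icc_of_isDoubleZero haM' h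
      ((Kerr.rMinus_pos (abs_pos.1 ha) haM').trans_le hr).ne' hr hd
    obtain ⟨hL, hQ⟩ := Kerr.abs_div_energy_le_of_isDoubleZero hM hM' h hE hrp hd
    exact ⟨⟨by linarith, by linarith⟩, by linarith, hQ⟩
  · intro M a hM _ haM E L Q h x hx hd
    obtain ⟨hmem, hvH, hvI⟩ := Kerr.isTimelike_of_isDoubleZero hM (hslow hM haM.le le_rfl) h hx hd
    have hfuture (ω : ℝ) : Kerr.IsFutureDirected (Kerr.dT + ω • Kerr.dPhi x) := by
      simp [Kerr.IsFutureDirected, Kerr.dT, Kerr.dPhi]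
    exact ⟨hmem, ⟨hvH, hfuture _⟩, hvI, by simp [Kerr.IsFutureDirected, Kerr.vI, Kerr.dT]⟩
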